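/- Let $P$ be a finite $(\mathbf 3+\mathbf 1)$-free poset (no element of $P$ is incomparable to all three elements of a chain $a<b<c$ in $P$), put $n=|P|$, and let $r$ be a positive integer. Let $\mathrm{inc}(P)$ be the incomparability graph of $P$, let $X_{\mathrm{inc}(P)}(\mathbf x)=\sum_\kappa\prod_{p\in P}x_{\kappa(p)}$ be its chromatic symmetric function (the sum is over all proper colorings $\kappa\colon P\to\mathbb Z_{>0}$), and let $c^P_\lambda\in\mathbb Z$ ($\lambda\vdash n$) be its (uniquely determined) coefficients in the elementary symmetric functions, $X_{\mathrm{inc}(P)}(\mathbf x)=\sum_{\lambda\vdash n}c^P_\lambda e_\lambda(\mathbf x)$. A $P$-tableau of skew shape $\nu/\theta$ is a filling $T$ of its boxes by elements of $P$ with $T(i,j)<_P T(i+1,j)$ and $T(i,j)\not>_P T(i,j+1)$ whenever both boxes lie in the shape. A cylindric $P$-tableau of shape $\lambda/\mu/d$ is a function $T\colon\lambda/\mu\to P$ such that $T^d$ is a $P$-tableau, where $T^d$ is obtained from $T$ by gluing a copy of the first column of $T$, shifted up by $d$ cells, to the right of the last column of $T$. It is standard if it contains each element of $P$ exactly once. Then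 $$\sum_{\substack{\lambda\vdash n\\ \lambda_1\le r}}c^P_\lambda=\#\{\,T : T\text{ is a standard cylindric } P\text{-tableau of shape } (r^c t)/\varnothing/1\,\},$$ where $(r^c t)$ is the partition of $n$ with the maximal number $c=\lfloor n/r\rfloor$ of rows of length $r$ and, if $t=n-cr>0$, one further row of length $t$. -/

import Mathlib

/-! ### The chromatic symmetric function and the elementary symmetric functions

Symmetric functions in the infinitely many variables `x₁, x₂, …` are formal power series with
variables indexed by the positive integers `ℕ+`. -/

namespace CylindricTableaux

/-- The exponent vector of the monomial `x_κ = ∏ v, x_{κ v}`. -/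
noncomputable def colorWeight {V : Type*} [Fintype V] (κ : V → ℕ+) : ℕ+ →₀ ℕ :=
  ∑ v, Finsupp.single (κ v) 1

/-- The chromatic symmetric function `X_G = ∑ κ, x_κ` of a finite graph `G`, the sum being over all
proper colorings `κ : V → ℤ_{>0}`: the coefficient of the monomial `x ^ m` is the number of proper
colorings `κ` with `x_κ = x ^ m` (a finite number, since `V` is finite). -/
noncomputable def chromaticSymm {V : Type*} [Fintype V] (G : SimpleGraph V) :
    MvPowerSeries ℕ+ ℤ :=
  fun m => (Nat.card {κ : G.Coloring ℕ+ // colorWeight (fun v => κ v) = m} : ℤ)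

open Classical in
/-- The elementary symmetric function `e_k = ∑_{i₁ < ⋯ < i_k} x_{i₁} ⋯ x_{i_k}`: the sum of all
squarefree monomials of degree `k`. -/
noncomputable def elemSymm (k : ℕ) : MvPowerSeries ℕ+ ℤ :=
  fun m => if (∀ i, m i ≤ 1) ∧ m.degree = k then 1 else 0

/-- `e_ν = e_{ν₁} e_{ν₂} ⋯` for a partition `ν`. -/
noncomputable def elemSymmPart {n : ℕ} (ν : Nat.Partition n) : MvPowerSeries ℕ+ ℤ :=
  (ν.parts.map elemSymm).prod

/-- `c` is the family of coefficients of `X_G` in the elementary symmetric functions: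
`X_G = ∑_ν c_ν e_ν`. As `X_G` is homogeneous of degree `|V|`, the sum is over partitions of
`|V|`. -/
def IsElemExpansion {V : Type*} [Fintype V] (G : SimpleGraph V)
    (c : Nat.Partition (Fintype.card V) → ℤ) : Prop :=
  chromaticSymm G = ∑ ν, c ν • elemSymmPart ν

/-! ### Posets -/

/-- The incomparability graph `inc(P)`. -/
def incGraph (P : Type*) [PartialOrder P] : SimpleGraph P where
  Adj a b := IncompRel (· ≤ ·) a b
  symm := ⟨fun _ _ h => h.symm⟩
  loopless := ⟨fun _ h => h.1 le_rfl⟩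

/-- `P` is `(3+1)`-free: no element of `P` is incomparable to every element of a three-element
chain of `P`. -/
def IsThreePlusOneFree (P : Type*) [PartialOrder P] : Prop :=
  ¬ ∃ a b c d : P, a < b ∧ b < c ∧
    IncompRel (· ≤ ·) a d ∧ IncompRel (· ≤ ·) b d ∧ IncompRel (· ≤ ·) c d

/-! ### Cylindric `P`-tableaux

A filling of a set of boxes by elements of `P` is a function `A : ℕ × ℕ → Option P`, with value
`none` outside the set. The box `(i, j)` lies in row `i` and column `j`, English style; rows and
columns are numbered from `0`. -/

/-- The boxes of the skew shape `lam / mu`. -/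
def skewCells (lam mu : YoungDiagram) : Finset (ℕ × ℕ) := lam.cells \ mu.cells

/-- A function on a finite set of boxes, as a filling. -/
def toFilling {P : Type*} {S : Finset (ℕ × ℕ)} (T : S → P) : ℕ × ℕ → Option P :=
  fun b => if h : b ∈ S then some (T ⟨b, h⟩) else none

/-- The `P`-tableau condition: `A (i, j) <_P A (i + 1, j)` and `A (i, j) ≯_P A (i, j + 1)`, whenever
both boxes belong to the shape. -/
def IsPTableau {P : Type*} [PartialOrder P] (A : ℕ × ℕ → Option P) : Prop :=
  (∀ i j a b, A (i, j) = some a → A (i + 1, j) = some b → a < b) ∧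
  (∀ i j a b, A (i, j) = some a → A (i, j + 1) = some b → ¬ b < a)

/-- The diagram `A ^ d` for a filling `A` with columns `0, …, l - 1`: a copy of the first column of
`A` is glued to the right of the last column, shifted up by `d` boxes relative to `A`. Thus the
columns of `A` move down by `d`, and the copy, in column `l`, keeps the original rows. -/
def glue {P : Type*} (A : ℕ × ℕ → Option P) (l d : ℕ) : ℕ × ℕ → Option P :=
  fun b =>
    if b.2 < l then (if d ≤ b.1 then A (b.1 - d, b.2) else none)
    else if b.2 = l then A (b.1, 0) else none

/-- `T : lam / mu → P` is a cylindric `P`-tableau of shape `lam / mu / d`, i.e. `T ^ d` is a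
`P`-tableau. (As usual this is meant for `mu ⊆ lam` and for `d` large enough that the boxes of
`T ^ d` form a skew shape.) The number of columns of `lam` is `lam.rowLen 0`. -/
def IsCylindricPTableau {P : Type*} [PartialOrder P] (lam mu : YoungDiagram) (d : ℕ)
    (T : skewCells lam mu → P) : Prop :=
  IsPTableau (glue (toFilling T) (lam.rowLen 0) d)

/-- The set of standard cylindric `P`-tableaux of shape `lam / mu / d`: those which contain each
element of `P` exactly once. -/
def standardCylindric (P : Type*) [PartialOrder P] (lam mu : YoungDiagram) (d : ℕ) :
    Set (skewCells lam mu → P) :=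
  {T | IsCylindricPTableau lam mu d T ∧ ∀ p : P, ∃! b, T b = p}

theorem sortedGE_replicate_append (n r : ℕ) :
    (List.replicate (n / r) r ++ [n % r]).SortedGE := by
  rw [List.sortedGE_iff_pairwise, List.pairwise_append]
  refine ⟨List.pairwise_replicate.2 (Or.inr le_rfl), List.pairwise_singleton _ _, ?_⟩
  intro a ha b hb
  obtain ⟨h0, rfl⟩ := List.mem_replicate.1 ha
  rw [List.mem_singleton.1 hb]
  rcases Nat.eq_zero_or_pos a with rfl | h
  · simp at h0
  · exact (Nat.mod_lt n h).le

/-- The partition `(r^c t)` of `n` with the maximal number `c = ⌊n / r⌋` of rows of length `r`,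
followed by one row with the remaining `t = n - c r` boxes (an empty row if `t = 0`). -/
def rowsDiagram (n r : ℕ) : YoungDiagram :=
  YoungDiagram.ofRowLens (List.replicate (n / r) r ++ [n % r]) (sortedGE_replicate_append n r)

end CylindricTableaux

/-!
Let `ζ` be a primitive `(r + 1)`-th root of unity. Substituting `ζ, ζ ^ 2, …, ζ ^ r` for `r`
variables and `0` for the others turns `e_k` into `(-1) ^ k` if `k ≤ r` and into `0` if `k > r`.
Hence it turns `X_{inc(P)}` into `(-1) ^ n` times the sum of the `c_ν` with `ν₁ ≤ r`.

Multiply this by a Vandermonde determinant and expand. A proper coloring with `r` colors is an array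
of `r` chains, and it contributes the alternant `det (y_i ^ E_j)`, where `E_j` is the first empty
position of the `j`-th chain in the array, read row by row. As the `y_i` are `(r + 1)`-th roots of
unity, only the `E_j` modulo `r + 1` matter. A flaw of the array is an entry which comes after a
larger entry or an empty position. Exchanging the tails of the two chains involved in an early flaw
moves their entries by `r + 1` positions, so it exchanges two rows of the alternant and changes its
sign; that the columns are still chains is where `(3+1)`-freeness comes in. So the arrays with flaws
cancel. In an array without flaws the `E_j` are the `r` consecutive numbers `n, …, n + r - 1` in
cyclic order, and its alternant is `(-1) ^ n` times the Vandermonde determinant. These arrays are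
the standard cylindric tableaux of shape `(r^c t)/∅/1`, read row by row.
-/

namespace CylindricTableaux

open Finset MvPolynomial

/-! ### Partitions and the fundamental theorem of symmetric polynomials -/

section Symmetric

theorem weight_one_eq_degree {σ : Type*} (α : σ →₀ ℕ) : Finsupp.weight 1 α = α.degree := by
  rw [Finsupp.degree_eq_weight_one]
  rfl

theorem sum_single_one_eq_iff {σ : Type*} {s : Finset σ} {α : σ →₀ ℕ} :
    ∑ i ∈ s, Finsupp.single i 1 = α ↔ (∀ i, α i ≤ 1) ∧ α.support = s := by
  classical
  have apply_sum (i : σ) : (∑ j ∈ s, Finsupp.single j 1 : σ →₀ ℕ) i = if i ∈ s then 1 else 0 := by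
    simp [Finsupp.single_apply]
  constructor
  · rintro rfl
    refine ⟨fun i => ?_, ?_⟩
    · rw [apply_sum]; split_ifs <;> simp
    · ext i; simp [apply_sum]
  · rintro ⟨hα, rfl⟩
    ext i
    have := hα i
    rw [apply_sum]
    split_ifs with hi <;> simp only [Finsupp.mem_support_iff] at hi <;> omega

variable {σ R : Type*} [Fintype σ] [CommRing R]

open Classical in
theorem coeff_esymm (k : ℕ) (α : σ →₀ ℕ) :
    coeff α (esymm σ R k) = if (∀ i, α i ≤ 1) ∧ α.degree = k then 1 else 0 := by
  simp only [esymm_eq_sum_monomial, coeff_sum, coeff_monomial, sum_single_one_eq_iff, ite_and]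
  split_ifs with hα hk
  all_goals simp only [sum_const_zero, sum_ite_eq, mem_powersetCard, subset_univ, true_and]
  all_goals
    have hcard : α.degree = #α.support := by
      conv_lhs => rw [← sum_single_one_eq_iff.2 ⟨hα, rfl⟩]
      simp [map_sum]
    simp [← hcard, hk]

theorem isHomogeneous_esymm (k : ℕ) : (esymm σ R k).IsHomogeneous k := by
  classical
  intro α hα
  rw [coeff_esymm] at hα
  rw [weight_one_eq_degree]
  exact (ite_ne_right_iff.1 hα).1.2

theorem isHomogeneous_prod_esymm (s : Multiset ℕ) :
    (s.map (esymm σ R)).prod.IsHomogeneous s.sum := by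
  induction s using Multiset.induction_on with
  | empty => simpa using isHomogeneous_one σ R
  | cons k s ih => simpa using (isHomogeneous_esymm k).mul ih

/-- The multiset in which `i + 1` has multiplicity `t i`: the monomial with exponents `t` in
`e₁, e₂, …` is the product of the `e_k` over `k` in this multiset. -/
def partsOf {m : ℕ} (t : Fin m →₀ ℕ) : Multiset ℕ := ∑ i, Multiset.replicate (t i) (i + 1)

theorem mem_partsOf {m : ℕ} {t : Fin m →₀ ℕ} {k : ℕ} :
    k ∈ partsOf t ↔ ∃ i, t i ≠ 0 ∧ k = i + 1 := by
  simp [partsOf, Multiset.mem_sum, Multiset.mem_replicate]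

theorem count_partsOf {m : ℕ} (t : Fin m →₀ ℕ) (i : Fin m) :
    (partsOf t).count (i + 1 : ℕ) = t i := by
  simp [partsOf, Multiset.count_sum', Multiset.count_replicate, Fin.val_inj]

theorem esymmAlgHomMonomial_eq {m : ℕ} (t : Fin m →₀ ℕ) (a : R) :
    esymmAlgHomMonomial σ t a = a • ((partsOf t).map (esymm σ R)).prod := by
  rw [esymmAlgHomMonomial, esymmAlgHom_apply, aeval_monomial, partsOf,
    ← Multiset.coe_mapAddMonoidHom, map_sum, Multiset.prod_sum, Finsupp.prod_fintype _ _ (by simp),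
    Algebra.smul_def]
  simp

theorem homogeneousComponent_esymmAlgHom_mem_span {m : ℕ} (d : ℕ) (q : MvPolynomial (Fin m) R) :
    homogeneousComponent d (esymmAlgHom σ R m q).val ∈
      Submodule.span R (Set.range fun ν : d.Partition => esymmPart σ R ν) := by
  induction q using MvPolynomial.induction_on' with
  | add p q hp hq =>
    rw [map_add, Subalgebra.coe_add, map_add]
    exact add_mem hp hq
  | monomial t a =>
    change homogeneousComponent d (esymmAlgHomMonomial σ t a) ∈ _
    rw [esymmAlgHomMonomial_eq, map_smul,
      homogeneousComponent_of_mem (isHomogeneous_prod_esymm (partsOf t))]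
    refine Submodule.smul_mem _ _ ?_
    split_ifs with hd
    · refine Submodule.subset_span ⟨⟨partsOf t, fun hk => ?_, hd.symm⟩, rfl⟩
      obtain ⟨i, -, rfl⟩ := mem_partsOf.1 hk
      exact Nat.succ_pos _
    · exact Submodule.zero_mem _

theorem mem_span_esymmPart {p : MvPolynomial σ R} {d : ℕ} (hsymm : p.IsSymmetric)
    (hhom : p.IsHomogeneous d) :
    p ∈ Submodule.span R (Set.range fun ν : d.Partition => esymmPart σ R ν) := by
  obtain ⟨q, hq⟩ := esymmAlgHom_surjective R (le_refl (Fintype.card σ)) ⟨p, hsymm⟩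
  have hmem := homogeneousComponent_esymmAlgHom_mem_span (σ := σ) d q
  rwa [hq, homogeneousComponent_of_mem hhom, if_pos rfl] at hmem

theorem partsOf_count {m d : ℕ} (hd : d ≤ m) (ν : d.Partition) :
    partsOf (Finsupp.equivFunOnFinite.symm fun i : Fin m => ν.parts.count (i + 1 : ℕ)) =
      ν.parts := by
  ext k
  by_cases hk : 0 < k ∧ k ≤ m
  · obtain ⟨k, rfl⟩ := Nat.exists_eq_add_one.2 hk.1
    exact count_partsOf _ (⟨k, hk.2⟩ : Fin m)
  · rw [Multiset.count_eq_zero_of_notMem, Multiset.count_eq_zero_of_notMem]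
    · intro hmem
      exact hk ⟨ν.parts_pos hmem, (ν.parts_sum ▸ Multiset.le_sum_of_mem hmem : k ≤ d).trans hd⟩
    · rintro hmem
      obtain ⟨i, -, rfl⟩ := mem_partsOf.1 hmem
      exact hk ⟨Nat.succ_pos _, i.2⟩

theorem linearIndependent_esymmPart {d : ℕ} (hd : d ≤ Fintype.card σ) :
    LinearIndependent R fun ν : d.Partition => esymmPart σ R ν := by
  let exps (ν : d.Partition) : Fin (Fintype.card σ) →₀ ℕ :=
    Finsupp.equivFunOnFinite.symm fun i => ν.parts.count (i + 1 : ℕ)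
  have exps_injective : Function.Injective exps := fun ν ν' h =>
    Nat.Partition.ext (by rw [← partsOf_count hd ν, ← partsOf_count hd ν']; exact congrArg _ h)
  let toPoly : MvPolynomial (Fin (Fintype.card σ)) R →ₗ[R] MvPolynomial σ R :=
    (symmetricSubalgebra σ R).val.toLinearMap ∘ₗ (esymmAlgHom σ R (Fintype.card σ)).toLinearMap
  have toPoly_injective : Function.Injective toPoly :=
    Subtype.val_injective.comp (esymmAlgHom_injective R le_rfl)
  have toPoly_monomial (ν : d.Partition) :
      toPoly (basisMonomials _ R (exps ν)) = esymmPart σ R ν := by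
    rw [coe_basisMonomials]
    change esymmAlgHomMonomial σ (exps ν) 1 = _
    rw [esymmAlgHomMonomial_eq, partsOf_count hd, one_smul, esymmPart]
  simpa only [Function.comp_def, toPoly_monomial] using
    ((basisMonomials _ R).linearIndependent.comp exps exps_injective).map' toPoly
      (LinearMap.ker_eq_bot.2 toPoly_injective)

end Symmetric

/-! ### Restriction to finitely many variables -/

section Restriction

variable {σ τ R : Type*}

theorem degree_embDomain (e : σ ↪ τ) (α : σ →₀ ℕ) :
    (Finsupp.embDomain e α).degree = α.degree := by
  simp [Finsupp.degree_apply, Finsupp.support_embDomain]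

-- A monomial of degree `n` involves at most `n` variables.
theorem eq_of_forall_killCompl_eq [CommSemiring R] [Infinite τ] {n : ℕ} {F G : MvPowerSeries τ R}
    (hF : F.IsHomogeneous n) (hG : G.IsHomogeneous n)
    (h : ∀ e : Fin n ↪ τ, MvPowerSeries.killCompl e F = MvPowerSeries.killCompl e G) : F = G := by
  ext μ
  by_cases hμ : μ.degree = n
  · have hcard : #μ.support ≤ n := by
      rw [← hμ, Finsupp.degree_apply, card_eq_sum_ones]
      exact sum_le_sum fun i hi => Nat.one_le_iff_ne_zero.2 (Finsupp.mem_support_iff.1 hi)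
    obtain ⟨T, hT, hTcard⟩ := Infinite.exists_superset_card_eq μ.support n hcard
    let e : Fin n ↪ τ :=
      (T.equivFinOfCardEq hTcard).symm.toEmbedding.trans (Function.Embedding.subtype _)
    obtain ⟨α, rfl⟩ : μ ∈ Set.range (Finsupp.embDomain e) := by
      rw [Finsupp.mem_range_embDomain_iff]
      exact fun i hi => ⟨T.equivFinOfCardEq hTcard ⟨i, hT hi⟩, by simp [e]⟩
    rw [← MvPowerSeries.coeff_killCompl, h e, MvPowerSeries.coeff_killCompl]
  · rw [hF.coeff_eq_zero hμ, hG.coeff_eq_zero hμ]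

theorem isHomogeneous_elemSymm (k : ℕ) : (elemSymm k).IsHomogeneous k := by
  classical
  intro μ hμ
  rw [weight_one_eq_degree]
  exact (ite_ne_right_iff.1 (show (if _ then _ else _) ≠ (0 : ℤ) from hμ)).1.2

theorem isHomogeneous_prod_elemSymm (s : Multiset ℕ) :
    (s.map elemSymm).prod.IsHomogeneous s.sum := by
  induction s using Multiset.induction_on with
  | empty =>
    intro μ hμ
    rw [Multiset.map_zero, Multiset.prod_zero, MvPowerSeries.coeff_one] at hμ
    simp [(ite_ne_right_iff.1 hμ).1]
  | cons k s ih =>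
    rw [Multiset.map_cons, Multiset.prod_cons, Multiset.sum_cons]
    exact MvPowerSeries.IsHomogeneous.mul (isHomogeneous_elemSymm k) ih

theorem isHomogeneous_sum_smul_elemSymmPart {n : ℕ} (c : n.Partition → ℤ) :
    (∑ ν, c ν • elemSymmPart ν).IsHomogeneous n := by
  intro μ hμ
  rw [map_sum] at hμ
  obtain ⟨ν, -, hν⟩ := exists_ne_zero_of_sum_ne_zero hμ
  rw [map_zsmul] at hν
  exact (isHomogeneous_prod_elemSymm ν.parts (right_ne_zero_of_smul hν)).trans ν.parts_sum

theorem killCompl_elemSymm [Fintype σ] (e : σ ↪ ℕ+) (k : ℕ) :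
    MvPowerSeries.killCompl e (elemSymm k) = (esymm σ ℤ k : MvPowerSeries σ ℤ) := by
  classical
  ext α
  rw [MvPowerSeries.coeff_killCompl, coeff_coe, coeff_esymm]
  change (if _ then _ else _) = _
  have hsquarefree : (∀ i, Finsupp.embDomain e α i ≤ 1) ↔ ∀ i, α i ≤ 1 := by
    refine ⟨fun h i => by simpa using h (e i), fun h i => ?_⟩
    by_cases hi : i ∈ Set.range e
    · obtain ⟨j, rfl⟩ := hi
      simpa using h j
    · simp [Finsupp.embDomain_of_notMem_range _ _ _ hi]
  simp only [degree_embDomain, hsquarefree]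

theorem killCompl_elemSymmPart [Fintype σ] {n : ℕ} (e : σ ↪ ℕ+) (ν : n.Partition) :
    MvPowerSeries.killCompl e (elemSymmPart ν) = (esymmPart σ ℤ ν : MvPowerSeries σ ℤ) := by
  rw [← coeToMvPowerSeries.ringHom_apply, elemSymmPart, esymmPart, map_multiset_prod,
    map_multiset_prod, Multiset.map_map, Multiset.map_map]
  exact congrArg _ (Multiset.map_congr rfl fun k _ => killCompl_elemSymm e k)

end Restriction

/-! ### The chromatic symmetric function in finitely many variables -/

section Chromatic

variable {V σ τ : Type*} [Fintype V] (G : SimpleGraph V)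

/-- The exponent vector of `∏ v, x_{κ v}`; it is `colorWeight` for an arbitrary set of colors. -/
noncomputable def colorExponent (κ : V → σ) : σ →₀ ℕ := ∑ v, Finsupp.single (κ v) 1

theorem degree_colorExponent (κ : V → σ) : (colorExponent κ).degree = Fintype.card V := by
  simp [colorExponent, map_sum]

theorem mapDomain_colorExponent (g : σ → τ) (κ : V → σ) :
    Finsupp.mapDomain g (colorExponent κ) = colorExponent (g ∘ κ) := by
  simp [colorExponent, Finsupp.mapDomain_finsetSum]

theorem mem_support_colorExponent (κ : V → σ) (v : V) : κ v ∈ (colorExponent κ).support := by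
  classical
  simp [colorExponent, Finsupp.finsetSum_apply, Finsupp.single_apply]

theorem isHomogeneous_chromaticSymm : (chromaticSymm G).IsHomogeneous (Fintype.card V) := by
  intro μ hμ
  have hcard : Nat.card {κ : G.Coloring ℕ+ // colorWeight κ = μ} ≠ 0 := Nat.cast_ne_zero.1 hμ
  obtain ⟨⟨κ, rfl⟩⟩ := (Nat.card_ne_zero.1 hcard).1
  rw [weight_one_eq_degree]
  exact degree_colorExponent κ

theorem image_recolorOfEmbedding (e : σ ↪ τ) (α : σ →₀ ℕ) :
    G.recolorOfEmbedding e '' {κ : G.Coloring σ | colorExponent κ = α} =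
      {κ : G.Coloring τ | colorExponent κ = Finsupp.embDomain e α} := by
  ext κ
  constructor
  · rintro ⟨κ, rfl, rfl⟩
    rw [Finsupp.embDomain_eq_mapDomain, mapDomain_colorExponent]
    rfl
  · intro hκ
    have hrange (v : V) : κ v ∈ Set.range e := by
      have hv := mem_support_colorExponent κ v
      rw [show colorExponent κ = _ from hκ, Finsupp.support_embDomain, mem_map] at hv
      obtain ⟨i, -, hi⟩ := hv
      exact ⟨i, hi⟩
    choose κ' hκ' using hrange
    refine ⟨.mk κ' fun {v w} hvw h => κ.valid hvw ?_, ?_, DFunLike.ext _ _ hκ'⟩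
    · rw [← hκ', ← hκ', h]
    · apply Finsupp.embDomain_injective e
      rw [Finsupp.embDomain_eq_mapDomain, mapDomain_colorExponent]
      exact (congrArg colorExponent (funext hκ')).trans hκ

open Classical in
/-- The chromatic symmetric polynomial: the restriction of `X_G` to the variables `x_i`, `i : σ`. -/
noncomputable def chromaticPoly (σ : Type*) [Fintype σ] : MvPolynomial σ ℤ :=
  ∑ κ : G.Coloring σ, monomial (colorExponent κ) 1

variable [Fintype σ]

theorem isHomogeneous_chromaticPoly : (chromaticPoly G σ).IsHomogeneous (Fintype.card V) :=
  IsHomogeneous.sum _ _ _ fun κ _ => isHomogeneous_monomial _ (degree_colorExponent κ)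

theorem isSymmetric_chromaticPoly : (chromaticPoly G σ).IsSymmetric := by
  classical
  intro π
  rw [chromaticPoly, map_sum]
  refine Fintype.sum_equiv (G.recolorOfEquiv π) _ _ fun κ => ?_
  rw [rename_monomial, mapDomain_colorExponent]
  rfl

theorem killCompl_chromaticSymm (e : σ ↪ ℕ+) :
    MvPowerSeries.killCompl e (chromaticSymm G) = (chromaticPoly G σ : MvPowerSeries σ ℤ) := by
  classical
  ext α
  rw [MvPowerSeries.coeff_killCompl, coeff_coe, chromaticPoly, coeff_sum]
  simp only [coeff_monomial]
  rw [← sum_filter, sum_const, nsmul_one, ← Set.ncard_coe_finset, coe_filter_univ,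
    ← Set.ncard_image_of_injective _ (G.recolorOfEmbedding e).injective, image_recolorOfEmbedding]
  rfl

variable {G}

theorem chromaticPoly_eq {c : Nat.Partition (Fintype.card V) → ℤ} (hc : IsElemExpansion G c) :
    chromaticPoly G σ = ∑ ν, c ν • esymmPart σ ℤ ν := by
  let e : σ ↪ ℕ+ := (Fintype.equivFin σ).toEmbedding.trans
    (Fin.valEmbedding.trans Equiv.pnatEquivNat.symm.toEmbedding)
  apply MvPolynomial.coe_injective
  rw [← killCompl_chromaticSymm G e, show chromaticSymm G = _ from hc,
    ← coeToMvPowerSeries.ringHom_apply]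
  simp only [map_sum, map_zsmul, killCompl_elemSymmPart, coeToMvPowerSeries.ringHom_apply]

theorem isElemExpansion_iff {c : Nat.Partition (Fintype.card V) → ℤ} :
    IsElemExpansion G c ↔ chromaticPoly G (Fin (Fintype.card V)) =
      ∑ ν, c ν • esymmPart (Fin (Fintype.card V)) ℤ ν := by
  refine ⟨chromaticPoly_eq, fun h => eq_of_forall_killCompl_eq (isHomogeneous_chromaticSymm G)
    (isHomogeneous_sum_smul_elemSymmPart c) fun e => ?_⟩
  rw [killCompl_chromaticSymm, h, ← coeToMvPowerSeries.ringHom_apply]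
  simp only [map_sum, map_zsmul, killCompl_elemSymmPart, coeToMvPowerSeries.ringHom_apply]

theorem existsUnique_isElemExpansion (G : SimpleGraph V) :
    ∃! c : Nat.Partition (Fintype.card V) → ℤ, IsElemExpansion G c := by
  obtain ⟨c, hc⟩ := (Submodule.mem_span_range_iff_exists_fun ℤ).1
    (mem_span_esymmPart (σ := Fin (Fintype.card V)) (isSymmetric_chromaticPoly G)
      (isHomogeneous_chromaticPoly G))
  refine ⟨c, isElemExpansion_iff.2 hc.symm, fun c' hc' => ?_⟩
  exact (linearIndependent_esymmPart (Fintype.card_fin _).ge).fintypeLinearCombination_injective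
    ((isElemExpansion_iff.1 hc').symm.trans hc.symm)

end Chromatic

/-! ### Evaluation at the nontrivial roots of unity -/

section RootsOfUnity

variable {R : Type*} [CommRing R] {r : ℕ} {ζ : R}

/-- The values `ζ, ζ², …, ζ ^ r` for the variables; if `ζ` is a primitive `(r + 1)`-th root of
unity, they are the `(r + 1)`-th roots of unity other than `1`. -/
def nontrivialRoot (r : ℕ) (ζ : R) (i : Fin r) : R := ζ ^ (i + 1 : ℕ)

theorem nontrivialRoot_pow (k : ℕ) (i : Fin r) :
    nontrivialRoot r (ζ ^ k) i = nontrivialRoot r ζ i ^ k :=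
  pow_right_comm ζ k _

theorem nontrivialRoot_pow_succ (hζ : IsPrimitiveRoot ζ (r + 1)) (i : Fin r) :
    nontrivialRoot r ζ i ^ (r + 1) = 1 := by
  rw [nontrivialRoot, pow_right_comm, hζ.pow_eq_one, one_pow]

theorem nontrivialRoot_injective (hζ : IsPrimitiveRoot ζ (r + 1)) :
    Function.Injective (nontrivialRoot r ζ) := fun i j hij =>
  Fin.ext (Nat.succ_injective (hζ.pow_inj (Nat.succ_lt_succ i.2) (Nat.succ_lt_succ j.2) hij))

theorem prod_map_pow_eq_pow_sum {M : Type*} [CommMonoid M] (a : M) (s : Multiset ℕ) :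
    (s.map fun k => a ^ k).prod = a ^ s.sum := by
  induction s using Multiset.induction_on with
  | empty => simp
  | cons k s ih => simp [pow_add, ih]

variable [IsDomain R]

theorem prod_X_sub_C_nontrivialRoot (hζ : IsPrimitiveRoot ζ (r + 1)) :
    ∏ i, (Polynomial.X - Polynomial.C (nontrivialRoot r ζ i)) =
      ∑ k ∈ range (r + 1), Polynomial.X ^ k := by
  have hprod := X_pow_sub_C_eq_prod hζ r.succ_pos (one_pow (r + 1))
  simp only [map_one, ← mul_geom_sum, prod_range_succ', pow_zero, mul_one] at hprod
  rw [mul_comm] at hprod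
  rw [mul_right_cancel₀ (Polynomial.X_sub_C_ne_zero 1) hprod, prod_range]
  rfl

theorem aeval_nontrivialRoot_esymm (hζ : IsPrimitiveRoot ζ (r + 1)) (k : ℕ) :
    aeval (nontrivialRoot r ζ) (esymm (Fin r) ℤ k) = if k ≤ r then (-1) ^ k else 0 := by
  split_ifs with hk
  · have hcoeff := Multiset.prod_X_sub_C_coeff (univ.val.map (nontrivialRoot r ζ))
      (k := r - k) (by simp)
    rw [Multiset.map_map, ← aeval_esymm_eq_multiset_esymm (Fin r) ℤ] at hcoeff
    change (∏ i, (Polynomial.X - Polynomial.C (nontrivialRoot r ζ i))).coeff _ = _ at hcoeff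
    have hlt : r - k < r + 1 := by omega
    simp only [prod_X_sub_C_nontrivialRoot hζ, Polynomial.finsetSum_coeff, Polynomial.coeff_X_pow,
      sum_ite_eq, mem_range, hlt, if_true, Multiset.card_map, card_val, card_univ, Fintype.card_fin,
      Nat.sub_sub_self hk] at hcoeff
    have sign_mul_self : (-1 : R) ^ k * (-1) ^ k = 1 := by rw [← mul_pow]; simp
    exact mul_left_cancel₀ (left_ne_zero_of_mul_eq_one sign_mul_self)
      (hcoeff.symm.trans sign_mul_self.symm)
  · rw [esymm, powersetCard_eq_empty.2 (by simpa using hk), sum_empty, map_zero]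

theorem prod_nontrivialRoot (hζ : IsPrimitiveRoot ζ (r + 1)) :
    ∏ i, nontrivialRoot r ζ i = (-1) ^ r := by
  have powersetCard_univ := powersetCard_self (univ : Finset (Fin r))
  rw [card_univ, Fintype.card_fin] at powersetCard_univ
  simpa [esymm, powersetCard_univ] using aeval_nontrivialRoot_esymm hζ r

theorem aeval_nontrivialRoot_esymmPart (hζ : IsPrimitiveRoot ζ (r + 1)) {n : ℕ} (ν : n.Partition) :
    aeval (nontrivialRoot r ζ) (esymmPart (Fin r) ℤ ν) =
      if ∀ k ∈ ν.parts, k ≤ r then (-1) ^ n else 0 := by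
  simp only [esymmPart, map_multiset_prod, Multiset.map_map, Function.comp_def,
    aeval_nontrivialRoot_esymm hζ]
  split_ifs with hν
  · rw [Multiset.map_congr rfl fun k hk => if_pos (hν k hk), prod_map_pow_eq_pow_sum, ν.parts_sum]
  · push Not at hν
    obtain ⟨k, hk, hrk⟩ := hν
    exact Multiset.prod_eq_zero (Multiset.mem_map.2 ⟨k, hk, if_neg hrk.not_ge⟩)

theorem aeval_nontrivialRoot_chromaticPoly (hζ : IsPrimitiveRoot ζ (r + 1)) {V : Type*} [Fintype V]
    {G : SimpleGraph V} {c : Nat.Partition (Fintype.card V) → ℤ} (hc : IsElemExpansion G c) :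
    aeval (nontrivialRoot r ζ) (chromaticPoly G (Fin r)) =
      (-1) ^ Fintype.card V * ((∑ ν with ∀ k ∈ ν.parts, k ≤ r, c ν : ℤ) : R) := by
  rw [chromaticPoly_eq hc, map_sum, sum_filter, Int.cast_sum, mul_sum]
  refine sum_congr rfl fun ν _ => ?_
  rw [map_zsmul, aeval_nontrivialRoot_esymmPart hζ, zsmul_eq_mul]
  split_ifs
  · exact mul_comm _ _
  · simp

end RootsOfUnity

/-! ### The chromatic polynomial times an alternant -/

section Alternant

variable {V σ R : Type*} [Fintype V] [Fintype σ] [CommRing R] (G : SimpleGraph V)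

open Classical in
theorem aeval_chromaticPoly (x : σ → R) :
    aeval x (chromaticPoly G σ) = ∑ κ : G.Coloring σ, ∏ v, x (κ v) := by
  refine (map_sum _ _ _).trans (sum_congr rfl fun κ _ => ?_)
  rw [aeval_monomial, map_one, one_mul, colorExponent, Finsupp.prod_fintype _ _ (by simp)]
  simp only [Finsupp.finsetSum_apply, Finsupp.single_apply, sum_boole, Nat.cast_id]
  simpa only [prod_const] using prod_fiberwise' univ κ x

open Classical in
theorem sum_coloring_prod_pow_card [DecidableEq σ] (x : σ → R) (π : Equiv.Perm σ) :
    ∑ κ : G.Coloring σ, ∏ i, x i ^ #{v | κ v = π i} = aeval x (chromaticPoly G σ) := by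
  rw [aeval_chromaticPoly]
  refine (Fintype.sum_equiv (G.recolorOfEquiv π) _ _ fun κ => ?_).symm
  rw [← prod_fiberwise' univ κ x]
  refine prod_congr rfl fun i _ => ?_
  rw [prod_const]
  congr 2
  ext v
  simp

open Classical in
theorem aeval_chromaticPoly_mul_det [DecidableEq σ] (x : σ → R) (M : Matrix σ σ R) :
    aeval x (chromaticPoly G σ) * M.det =
      ∑ κ : G.Coloring σ, (Matrix.of fun j i => M j i * x i ^ #{v | κ v = j}).det := by
  simp only [Matrix.det_apply', Matrix.of_apply, prod_mul_distrib]
  rw [sum_comm, mul_sum]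
  refine sum_congr rfl fun π _ => ?_
  rw [← sum_coloring_prod_pow_card G x π, mul_comm, mul_sum]
  exact sum_congr rfl fun κ _ => mul_assoc _ _ _

end Alternant

/-! ### Arrays -/

/-- `f` places the elements of `P` in an array of `r` chains: the elements of the `j`-th chain
occupy initial positions of the sequence `j, j + r, j + 2 * r, …`, in increasing order. -/
structure IsArray {P : Type*} [PartialOrder P] (r : ℕ) (f : P → ℕ) : Prop where
  injective : Function.Injective f
  lt_of_add : ∀ p p', f p' = f p + r → p < p'
  exists_add : ∀ p, r ≤ f p → ∃ p', f p' + r = f p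

/-- `E` is the first empty position of its chain. -/
structure IsChainEnd {P : Type*} (r : ℕ) (f : P → ℕ) (E : ℕ) : Prop where
  forall_ne : ∀ p, f p ≠ E
  exists_add : r ≤ E → ∃ p, f p + r = E

/-- The first empty position of the `j`-th chain, computed from the length of that chain. -/
def chainEnd {P : Type*} [Fintype P] (r : ℕ) (f : P → ℕ) (j : ℕ) : ℕ :=
  j + r * #{p | f p % r = j}

theorem exists_isChainEnd_add_mul {P : Type*} [Finite P] {r : ℕ} (f : P → ℕ)
    (hr : 0 < r) {j : ℕ} (hj : j < r) :
    ∃ k, IsChainEnd r f (j + r * k) := by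
  obtain ⟨b, hb⟩ := (Set.finite_range f).bddAbove
  have exists_empty : ∃ k, ∀ p, f p ≠ j + r * k := by
    refine ⟨b + 1, fun p => ne_of_lt ?_⟩
    calc f p ≤ b := hb (Set.mem_range_self p)
      _ < b + 1 := Nat.lt_succ_self _
      _ ≤ r * (b + 1) := Nat.le_mul_of_pos_left _ hr
      _ ≤ j + r * (b + 1) := Nat.le_add_left _ _
  classical
  refine ⟨Nat.find exists_empty, Nat.find_spec exists_empty, fun hle => ?_⟩
  obtain ⟨k, hk⟩ : ∃ k, Nat.find exists_empty = k + 1 := by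
    refine Nat.exists_eq_succ_of_ne_zero fun h => ?_
    rw [h] at hle
    omega
  have filled := Nat.find_min exists_empty (m := k) (by omega)
  push Not at filled
  obtain ⟨p, hp⟩ := filled
  exact ⟨p, by rw [hk, hp]; ring⟩

section Array

variable {P : Type*} [PartialOrder P] {r : ℕ} {f : P → ℕ}

theorem IsArray.exists_add_mul (hf : IsArray r f) (k x : ℕ) (p : P) (h : f p = x + r * k) :
    ∃ p', f p' = x := by
  induction k generalizing p with
  | zero => exact ⟨p, by simpa using h⟩
  | succ k ih =>
    rw [mul_add, mul_one, ← add_assoc] at h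
    obtain ⟨p', hp'⟩ := hf.exists_add p (by omega)
    exact ih p' (by omega)

theorem IsArray.lt_of_add_mul (hf : IsArray r f) (k : ℕ) (p p' : P)
    (h : f p' = f p + r * (k + 1)) : p < p' := by
  induction k generalizing p' with
  | zero => exact hf.lt_of_add p p' (by simpa using h)
  | succ k ih =>
    rw [mul_add, mul_one, ← add_assoc] at h
    obtain ⟨p'', hp''⟩ := hf.exists_add p' (by omega)
    exact (ih p'' (by omega)).trans (hf.lt_of_add _ _ hp''.symm)

theorem IsArray.lt_of_mod_eq (hf : IsArray r f) {p p' : P} (h : f p % r = f p' % r)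
    (hlt : f p < f p') : p < p' := by
  obtain ⟨k, hk⟩ := (Nat.modEq_iff_dvd' hlt.le).1 h
  rcases k with _ | k
  · rw [mul_zero] at hk
    omega
  · exact hf.lt_of_add_mul k p p' (by omega)

theorem IsChainEnd.lt (hf : IsArray r f) {E : ℕ} (hE : IsChainEnd r f E) {p : P}
    (h : f p % r = E % r) : f p < E := by
  by_contra! hle
  obtain ⟨k, hk⟩ := (Nat.modEq_iff_dvd' hle).1 h.symm
  obtain ⟨p', hp'⟩ := hf.exists_add_mul k E p (by omega)
  exact hE.forall_ne p' hp'

variable [Fintype P]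

theorem IsArray.card_lt (hr : 0 < r) (hf : IsArray r f) {E : ℕ}
    (hE : r ≤ E → ∃ p, f p + r = E) : #{p | f p % r = E % r ∧ f p < E} = E / r := by
  rw [← card_range (E / r)]
  refine card_bij (fun p _ => f p / r) (fun p hp => ?_) (fun p hp p' hp' h => ?_) fun i hi => ?_
  · obtain ⟨hmod, hlt⟩ := mem_filter_univ p |>.1 hp
    rw [mem_range]
    by_contra! hle
    refine hlt.not_ge ?_
    rw [← Nat.mod_add_div E r, ← Nat.mod_add_div (f p) r, hmod]
    gcongr
  · rw [mem_filter_univ] at hp hp'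
    exact hf.injective <| by
      rw [← Nat.mod_add_div (f p) r, ← Nat.mod_add_div (f p') r, hp.1, hp'.1, h]
  · rw [mem_range] at hi
    obtain ⟨k, hk⟩ := Nat.exists_eq_add_of_lt hi
    have position_add : E % r + r * i + r * k + r = E := by
      conv_rhs => rw [← Nat.mod_add_div E r, hk]
      ring
    obtain ⟨p, hp⟩ := hE (by omega)
    obtain ⟨p', hp'⟩ := hf.exists_add_mul k (E % r + r * i) p (by omega)
    refine ⟨p', ?_, ?_⟩
    · rw [mem_filter_univ, hp', Nat.add_mul_mod_self_left, Nat.mod_mod]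
      exact ⟨rfl, by omega⟩
    · rw [hp', Nat.add_mul_div_left _ _ hr, Nat.div_eq_of_lt (Nat.mod_lt _ hr), zero_add]

theorem IsChainEnd.chainEnd_eq (hr : 0 < r) (hf : IsArray r f) {E : ℕ} (hE : IsChainEnd r f E) :
    chainEnd r f (E % r) = E := by
  have card_mod_eq : #{p | f p % r = E % r} = E / r := by
    rw [← hf.card_lt hr hE.exists_add]
    exact congrArg card (filter_congr fun p _ => (and_iff_left_of_imp fun h => hE.lt hf h).symm)
  rw [chainEnd, card_mod_eq, Nat.mod_add_div]

theorem IsArray.isChainEnd_chainEnd (hf : IsArray r f) (j : Fin r) :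
    IsChainEnd r f (chainEnd r f j) ∧ chainEnd r f j % r = j := by
  obtain ⟨k, hk⟩ := exists_isChainEnd_add_mul f j.pos j.isLt
  have position_mod : ((j : ℕ) + r * k) % r = j := by
    rw [Nat.add_mul_mod_self_left, Nat.mod_eq_of_lt j.isLt]
  have chainEnd_eq := hk.chainEnd_eq j.pos hf
  rw [position_mod] at chainEnd_eq
  rw [chainEnd_eq]
  exact ⟨hk, position_mod⟩

end Array

/-! ### Flaws and the exchange of tails -/

/-- The array `f` has a flaw at `q`: position `q + 1` is filled, and position `q` is empty or has a
larger entry. -/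
def HasFlaw {P : Type*} [PartialOrder P] (f : P → ℕ) (q : ℕ) : Prop :=
  ∃ p', f p' = q + 1 ∧ ∀ p, f p = q → p' < p

/-- A flaw at `q`, and no flaw before `q - 1`. -/
structure IsEarlyFlaw {P : Type*} [PartialOrder P] (f : P → ℕ) (q : ℕ) : Prop where
  hasFlaw : HasFlaw f q
  not_hasFlaw : ∀ x, x + 1 < q → ¬ HasFlaw f x

/-- The positions `q, q + r, q + 2 * r, …`. -/
def tail (r q : ℕ) : Set ℕ := {x | ∃ k, x = q + r * k}

open Classical in
/-- The exchange of the positions `q + k * r` and `q + 1 + (k + 1) * r`, for all `k`. -/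
noncomputable def tailSwap (r q x : ℕ) : ℕ :=
  if x ∈ tail r q then x + (r + 1) else if x ∈ tail r (q + 1 + r) then x - (r + 1) else x

section TailSwap

variable {r q x : ℕ}

theorem le_of_mem_tail (h : x ∈ tail r q) : q ≤ x := by
  obtain ⟨k, rfl⟩ := h
  exact Nat.le_add_right _ _

theorem mod_eq_of_mem_tail (h : x ∈ tail r q) : x % r = q % r := by
  obtain ⟨k, rfl⟩ := h
  exact Nat.add_mul_mod_self_left _ _ _

theorem mem_tail_of_mod_eq (hle : q ≤ x) (h : x % r = q % r) : x ∈ tail r q := by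
  obtain ⟨k, hk⟩ := (Nat.modEq_iff_dvd' hle).1 h.symm
  exact ⟨k, by omega⟩

theorem add_mem_tail_add_iff (m : ℕ) : x + m ∈ tail r (q + m) ↔ x ∈ tail r q :=
  exists_congr fun k => by omega

theorem add_mem_tail_iff (h : x + r ≠ q) : x + r ∈ tail r q ↔ x ∈ tail r q := by
  refine ⟨?_, fun ⟨k, hk⟩ => ⟨k + 1, by rw [hk]; ring⟩⟩
  rintro ⟨_ | k, hk⟩
  · exact absurd hk (by simpa using h)
  · exact ⟨k, by rw [mul_add] at hk; omega⟩

theorem mod_ne_succ_mod (hr : 2 ≤ r) (q : ℕ) : q % r ≠ (q + 1) % r := by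
  intro h
  have r_dvd_one : r ∣ 1 := by simpa using (Nat.modEq_iff_dvd' (Nat.le_succ q)).1 h
  exact absurd (Nat.le_of_dvd one_pos r_dvd_one) (by omega)

theorem notMem_tail_of_mem_tail (hr : 2 ≤ r) (h : x ∈ tail r (q + 1 + r)) : x ∉ tail r q :=
  fun h' => mod_ne_succ_mod hr q <| by
    rw [← mod_eq_of_mem_tail h', mod_eq_of_mem_tail h, Nat.add_mod_right]

theorem tailSwap_left (h : x ∈ tail r q) : tailSwap r q x = x + (r + 1) := if_pos h

theorem tailSwap_right (hr : 2 ≤ r) (h : x ∈ tail r (q + 1 + r)) :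
    tailSwap r q x = x - (r + 1) :=
  (if_neg (notMem_tail_of_mem_tail hr h)).trans (if_pos h)

theorem tailSwap_of_notMem (h : x ∉ tail r q) (h' : x ∉ tail r (q + 1 + r)) :
    tailSwap r q x = x :=
  (if_neg h).trans (if_neg h')

theorem tailSwap_of_lt (h : x < q) : tailSwap r q x = x :=
  tailSwap_of_notMem (fun h' => absurd (le_of_mem_tail h') (by omega))
    fun h' => absurd (le_of_mem_tail h') (by omega)

theorem tailSwap_self (r q : ℕ) : tailSwap r q q = q + 1 + r := by
  rw [tailSwap_left ⟨0, by simp⟩]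
  ring

theorem tailSwap_of_lt_of_lt (h : q < x) (h' : x < q + r) : tailSwap r q x = x := by
  refine tailSwap_of_notMem ?_ fun h' => absurd (le_of_mem_tail h') (by omega)
  rintro ⟨_ | k, hk⟩
  · omega
  · rw [mul_add] at hk
    omega

theorem tailSwap_involutive (hr : 2 ≤ r) (q : ℕ) : Function.Involutive (tailSwap r q) := by
  intro x
  by_cases left : x ∈ tail r q
  · have right : x + (r + 1) ∈ tail r (q + 1 + r) := by
      rwa [add_right_comm q, add_assoc q, add_mem_tail_add_iff]
    rw [tailSwap_left left, tailSwap_right hr right, Nat.add_sub_cancel]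
  by_cases right : x ∈ tail r (q + 1 + r)
  · have le := le_of_mem_tail right
    have left' : x - (r + 1) ∈ tail r q := by
      rw [← add_mem_tail_add_iff (r + 1), Nat.sub_add_cancel (by omega)]
      convert right using 2
      ring
    rw [tailSwap_right hr right, tailSwap_left left', Nat.sub_add_cancel (by omega)]
  rw [tailSwap_of_notMem left right, tailSwap_of_notMem left right]

theorem tailSwap_tailSwap_add_right (hr : 2 ≤ r) (q : ℕ) : tailSwap r q (q + 1 + r) = q := by
  rw [← tailSwap_self, tailSwap_involutive hr]

theorem tailSwap_add (h : x + r ≠ q) (h' : x ≠ q + 1) :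
    tailSwap r q (x + r) = tailSwap r q x + r := by
  have h'' : x + r ≠ q + 1 + r := by omega
  classical
  rw [tailSwap, tailSwap,
    if_congr (add_mem_tail_iff h) rfl (if_congr (add_mem_tail_iff h'') rfl rfl)]
  split_ifs with left right
  · ring
  · have := le_of_mem_tail right
    omega
  · rfl

theorem tailSwap_modEq (r q x : ℕ) : tailSwap r q x ≡ x [MOD r + 1] := by
  rw [tailSwap]
  split_ifs with left right
  · exact Nat.add_mod_right _ _
  · refine ((Nat.modEq_iff_dvd' (Nat.sub_le _ _)).2 ?_)
    rw [Nat.sub_sub_self (by have := le_of_mem_tail right; omega)]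
  · rfl

end TailSwap

section EarlyFlaw

variable {P : Type*} [PartialOrder P] {r q : ℕ} {f : P → ℕ}

theorem IsArray.exists_before_flaw (hr : 2 ≤ r) (hf : IsArray r f) (hq : IsEarlyFlaw f q)
    (h : r ≤ q) : ∃ a b c, f a + r = q ∧ f b + r = q + 1 ∧ f c = q + 1 ∧ b < c ∧ ¬ b < a := by
  obtain ⟨c, hc, -⟩ := hq.hasFlaw
  obtain ⟨b, hb⟩ := hf.exists_add c (by omega)
  have no_flaw := hq.not_hasFlaw (q - r) (by omega)
  simp only [HasFlaw, not_exists, not_and, not_forall] at no_flaw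
  obtain ⟨a, ha, hba⟩ := no_flaw b (by omega)
  exact ⟨a, b, c, by omega, by omega, hc, hf.lt_of_add _ _ hb.symm, hba⟩

theorem IsArray.lt_of_flaw (hP : IsThreePlusOneFree P) (hr : 2 ≤ r) (hf : IsArray r f)
    (hq : IsEarlyFlaw f q) {a d : P} (ha : f a + r = q) (hd : f d = q + 1 + r) : a < d := by
  obtain ⟨a', b, c, ha', hb, hc, hbc, hba⟩ := hf.exists_before_flaw hr hq (by omega)
  obtain rfl : a = a' := hf.injective (by omega)
  have hcd : c < d := hf.lt_of_add _ _ (by omega)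
  by_contra had
  have ne_of_position_ne : ∀ {x y : P}, f x ≠ f y → x ≠ y := fun h h' => h (h' ▸ rfl)
  have hab : ¬ a ≤ b := fun h => had ((h.trans_lt hbc).trans hcd)
  have hac : ¬ a ≤ c := fun h => had (h.trans_lt hcd)
  have had' : ¬ a ≤ d := fun h => had (h.lt_of_ne (ne_of_position_ne (by omega)))
  have hba' : ¬ b ≤ a := fun h => hba (h.lt_of_ne (ne_of_position_ne (by omega)))
  exact hP ⟨b, c, d, a, hbc, hcd, ⟨hba', hab⟩, ⟨fun h => hba' (hbc.le.trans h), hac⟩,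
    ⟨fun h => hba' (hbc.le.trans (hcd.le.trans h)), had'⟩⟩

theorem IsArray.tailSwap_comp (hP : IsThreePlusOneFree P) (hr : 2 ≤ r) (hf : IsArray r f)
    (hq : IsEarlyFlaw f q) : IsArray r (tailSwap r q ∘ f) := by
  have involutive := tailSwap_involutive hr q
  obtain ⟨c, hc, c_lt⟩ := hq.hasFlaw
  have tailSwap_succ : tailSwap r q (q + 1) = q + 1 :=
    tailSwap_of_lt_of_lt (by omega) (by omega)
  refine ⟨involutive.injective.comp hf.injective, fun p p' h => ?_, fun p h => ?_⟩
  · dsimp only [Function.comp_apply] at h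
    rw [involutive.eq_iff] at h
    by_cases before : f p + r = q
    · rw [tailSwap_of_lt (x := f p) (by omega), before, tailSwap_self] at h
      exact hf.lt_of_flaw hP hr hq before h
    by_cases flaw : f p = q + 1
    · rw [flaw, tailSwap_succ, tailSwap_tailSwap_add_right hr] at h
      rw [hf.injective (flaw.trans hc.symm)]
      exact c_lt p' h
    rw [← tailSwap_add before flaw, involutive] at h
    exact hf.lt_of_add p p' h
  · obtain ⟨y, hy⟩ := Nat.exists_eq_add_of_le' h
    dsimp only [Function.comp_apply] at hy ⊢
    suffices ∃ p', f p' = tailSwap r q y by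
      obtain ⟨p', hp'⟩ := this
      exact ⟨p', by rw [hp', involutive, hy]⟩
    rw [involutive.eq_iff] at hy
    by_cases before : y + r = q
    · obtain ⟨a, -, -, ha, -⟩ := hf.exists_before_flaw hr hq (by omega)
      exact ⟨a, by rw [tailSwap_of_lt (by omega)]; omega⟩
    by_cases flaw : y = q + 1
    · exact ⟨c, by rw [flaw, tailSwap_succ, hc]⟩
    rw [tailSwap_add before flaw] at hy
    obtain ⟨p', hp'⟩ := hf.exists_add p (by omega)
    exact ⟨p', by omega⟩

theorem IsChainEnd.tailSwap_comp (hr : 2 ≤ r) (hf : IsArray r f) (hq : IsEarlyFlaw f q) {E : ℕ}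
    (hE : IsChainEnd r f E) : IsChainEnd r (tailSwap r q ∘ f) (tailSwap r q E) := by
  have involutive := tailSwap_involutive hr q
  obtain ⟨c, hc, -⟩ := hq.hasFlaw
  have tailSwap_c : tailSwap r q (f c) = q + 1 := by
    rw [hc, tailSwap_of_lt_of_lt (by omega) (by omega)]
  refine ⟨fun p h => hE.forall_ne p (involutive.injective h), fun h => ?_⟩
  dsimp only [Function.comp_apply]
  by_cases at_flaw : E = q
  · exact ⟨c, by rw [tailSwap_c, at_flaw, tailSwap_self]⟩
  by_cases after_flaw : E = q + 1 + r
  · rw [after_flaw, tailSwap_tailSwap_add_right hr] at h ⊢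
    obtain ⟨a, -, -, ha, -⟩ := hf.exists_before_flaw hr hq h
    exact ⟨a, by rw [tailSwap_of_lt (by omega), ha]⟩
  have hrE : r ≤ E := by
    by_contra! hlt
    rcases lt_or_gt_of_ne at_flaw with hlt' | hlt'
    · rw [tailSwap_of_lt hlt'] at h
      omega
    · rw [tailSwap_of_lt_of_lt hlt' (by omega)] at h
      omega
  obtain ⟨p, rfl⟩ := hE.exists_add hrE
  exact ⟨p, (tailSwap_add at_flaw (by omega)).symm⟩

/-- The chain ends in the two chains involved in a flaw lie in the tails to be exchanged. -/
theorem IsChainEnd.tailSwap_mod (hr : 2 ≤ r) (hf : IsArray r f) (hq : IsEarlyFlaw f q) {E : ℕ}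
    (hE : IsChainEnd r f E) :
    tailSwap r q E % r = Equiv.swap (q % r) ((q + 1) % r) (E % r) := by
  obtain ⟨c, hc, -⟩ := hq.hasFlaw
  by_cases left : E % r = q % r
  · have hqE : q ≤ E := by
      by_cases hrq : r ≤ q
      · obtain ⟨a, -, -, ha, -⟩ := hf.exists_before_flaw hr hq hrq
        have ha' : f a % r = E % r := by rw [left, ← ha, Nat.add_mod_right]
        obtain ⟨k, hk⟩ := mem_tail_of_mod_eq (hE.lt hf ha').le ha'.symm
        rcases k with _ | k
        · exact absurd hk.symm (by simpa using hE.forall_ne a)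
        · rw [mul_add] at hk
          omega
      · rw [Nat.mod_eq_of_lt (not_le.1 hrq)] at left
        exact left ▸ Nat.mod_le _ _
    rw [left, Equiv.swap_apply_left, tailSwap_left (mem_tail_of_mod_eq hqE left), ← add_assoc,
      add_right_comm, Nat.add_mod_right, Nat.add_mod, left, ← Nat.add_mod]
  by_cases right : E % r = (q + 1) % r
  · have hcE : f c % r = E % r := by rw [hc, right]
    have hlt := hE.lt hf hcE
    obtain ⟨k, rfl⟩ := mem_tail_of_mod_eq hlt.le hcE.symm
    rcases k with _ | k
    · omega
    rw [right, Equiv.swap_apply_right, hc, tailSwap_right hr ⟨k, by ring⟩,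
      show q + 1 + r * (k + 1) - (r + 1) = q + r * k by rw [mul_add]; omega,
      Nat.add_mul_mod_self_left]
  rw [Equiv.swap_apply_of_ne_of_ne left right, tailSwap_of_notMem]
  · exact fun h => left (mod_eq_of_mem_tail h)
  · exact fun h => right (by rw [mod_eq_of_mem_tail h, Nat.add_mod_right])

end EarlyFlaw

/-! ### The alternant of an array -/

/-- The alternant `det (y i ^ E j)`, where `E j` is the first empty position of the `j`-th chain of
the array `f`. -/
def chainAlternant {P R : Type*} [Fintype P] [CommRing R] {r : ℕ} (y : Fin r → R) (f : P → ℕ) : R :=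
  (Matrix.of fun j i : Fin r => y i ^ chainEnd r f j).det

theorem chainAlternant_tailSwap_comp {P R : Type*} [PartialOrder P] [Fintype P] [CommRing R]
    {r q : ℕ} {f : P → ℕ} {y : Fin r → R} (hy : ∀ i, y i ^ (r + 1) = 1)
    (hP : IsThreePlusOneFree P) (hr : 2 ≤ r) (hf : IsArray r f) (hq : IsEarlyFlaw f q) :
    chainAlternant y (tailSwap r q ∘ f) = - chainAlternant y f := by
  have hr0 : 0 < r := by omega
  let a : Fin r := ⟨q % r, Nat.mod_lt _ hr0⟩
  let b : Fin r := ⟨(q + 1) % r, Nat.mod_lt _ hr0⟩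
  have hab : a ≠ b := fun h => mod_ne_succ_mod hr q (congrArg Fin.val h)
  have chainEnd_swap (j : Fin r) :
      chainEnd r (tailSwap r q ∘ f) (Equiv.swap a b j) = tailSwap r q (chainEnd r f j) := by
    obtain ⟨hE, hmod⟩ := hf.isChainEnd_chainEnd j
    have swap_val : (Equiv.swap a b j : ℕ) = tailSwap r q (chainEnd r f j) % r := by
      rw [hE.tailSwap_mod hr hf hq, hmod]
      exact Fin.val_injective.swap_apply a b j |>.symm
    rw [swap_val, (hE.tailSwap_comp hr hf hq).chainEnd_eq hr0 (hf.tailSwap_comp hP hr hq)]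
  have pow_eq (i j : Fin r) :
      y i ^ chainEnd r (tailSwap r q ∘ f) (Equiv.swap a b j) = y i ^ chainEnd r f j := by
    rw [chainEnd_swap, pow_eq_pow_mod _ (hy i), tailSwap_modEq, ← pow_eq_pow_mod _ (hy i)]
  have det_swap := Matrix.det_permute (Equiv.swap a b)
    (Matrix.of fun j i : Fin r => y i ^ chainEnd r (tailSwap r q ∘ f) j)
  rw [Equiv.Perm.sign_swap hab] at det_swap
  simp only [chainAlternant, ← pow_eq]
  rw [eq_comm, neg_eq_iff_eq_neg]
  simpa [Matrix.submatrix] using det_swap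

/-! ### Arrays and proper colorings -/

section Coloring

variable {P : Type*} [PartialOrder P]

theorem le_or_ge_of_coloring_eq {σ : Type*} (κ : (incGraph P).Coloring σ) {p p' : P}
    (h : κ p = κ p') : p ≤ p' ∨ p' ≤ p := by
  by_contra! incomp
  exact κ.valid (v := p) (w := p') incomp h

variable [Fintype P]

open Classical in
/-- The number of elements below `p` which have the same color as `p`. -/
noncomputable def chainRank {σ : Type*} (κ : P → σ) (p : P) : ℕ := #{p' | κ p' = κ p ∧ p' < p}

theorem chainRank_lt_chainRank {σ : Type*} {κ : P → σ} {p p' : P} (hκ : κ p = κ p')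
    (hlt : p < p') : chainRank κ p < chainRank κ p' := by
  classical
  refine card_lt_card (ssubset_iff_of_subset ?_ |>.2 ⟨p, ?_, ?_⟩)
  · intro x
    simp only [mem_filter_univ]
    exact fun ⟨hx, hxp⟩ => ⟨hx.trans hκ, hxp.trans hlt⟩
  · exact mem_filter_univ p |>.2 ⟨hκ, hlt⟩
  · simp

variable {σ : Type*} (κ : (incGraph P).Coloring σ)

theorem lt_of_chainRank_lt {p p' : P} (h : κ p = κ p') (hlt : chainRank κ p < chainRank κ p') :
    p < p' := by
  rcases le_or_ge_of_coloring_eq κ h with hle | hle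
  · exact hle.lt_of_ne fun heq => hlt.ne (heq ▸ rfl)
  · rcases hle.eq_or_lt with rfl | hlt'
    · exact absurd hlt (lt_irrefl _)
    · exact absurd (chainRank_lt_chainRank h.symm hlt') hlt.asymm

theorem exists_chainRank_add_one {p : P} (h : 0 < chainRank κ p) :
    ∃ p', κ p' = κ p ∧ chainRank κ p' + 1 = chainRank κ p := by
  classical
  obtain ⟨p', hp', maximal⟩ := exists_maximal (card_pos.1 h)
  obtain ⟨hκ, hlt⟩ := mem_filter_univ p' |>.1 hp'
  refine ⟨p', hκ, ?_⟩
  rw [chainRank, chainRank, ← card_insert_of_notMem (a := p') (by simp)]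
  congr 1
  ext x
  simp only [mem_insert, mem_filter_univ]
  constructor
  · rintro (rfl | ⟨hx, hxlt⟩)
    exacts [⟨hκ, hlt⟩, ⟨hx.trans hκ, hxlt.trans hlt⟩]
  · rintro ⟨hx, hxlt⟩
    rcases le_or_ge_of_coloring_eq κ (hx.trans hκ.symm) with hle | hle
    · exact hle.eq_or_lt.imp_right fun h => ⟨hx.trans hκ.symm, h⟩
    · exact Or.inl ((maximal (mem_filter_univ x |>.2 ⟨hx, hxlt⟩) hle).antisymm hle)

end Coloring

section Arrays

variable {P : Type*} [PartialOrder P] [Fintype P] {r : ℕ} {f : P → ℕ}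

variable (P r) in
open Classical in
/-- The finite set of all arrays of `r > 0` chains. The bound on the positions only serves to make
it finite. -/
noncomputable def arrays : Finset (P → ℕ) :=
  {f ∈ Fintype.piFinset fun _ : P => range (r * (Fintype.card P + 1)) | IsArray r f}

theorem mem_arrays (hr : 0 < r) : f ∈ arrays P r ↔ IsArray r f := by
  classical
  rw [arrays, mem_filter, Fintype.mem_piFinset, and_iff_right_iff_imp]
  intro hf p
  obtain ⟨hE, hmod⟩ := hf.isChainEnd_chainEnd ⟨f p % r, Nat.mod_lt _ hr⟩
  have card_le : #{p' | f p' % r = f p % r} ≤ Fintype.card P := card_le_univ _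
  rw [mem_range]
  calc f p < f p % r + r * #{p' | f p' % r = f p % r} := hE.lt hf hmod.symm
    _ < r + r * Fintype.card P :=
      add_lt_add_of_lt_of_le (Nat.mod_lt _ hr) (Nat.mul_le_mul_left r card_le)
    _ = r * (Fintype.card P + 1) := by ring

/-- The array which lists the color classes of `κ` in increasing order. -/
noncomputable def coloringArray (κ : (incGraph P).Coloring (Fin r)) (p : P) : ℕ :=
  κ p + r * chainRank κ p

theorem coloringArray_mod (κ : (incGraph P).Coloring (Fin r)) (p : P) :
    coloringArray κ p % r = κ p := by
  rw [coloringArray, Nat.add_mul_mod_self_left, Nat.mod_eq_of_lt (κ p).isLt]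

theorem chainRank_eq_of_coloringArray_eq (κ : (incGraph P).Coloring (Fin r)) {p p' : P} {k : ℕ}
    (h : coloringArray κ p' = coloringArray κ p + r * k) :
    κ p' = κ p ∧ chainRank κ p' = chainRank κ p + k := by
  have color_eq : κ p' = κ p := Fin.ext <| by
    rw [← coloringArray_mod, h, Nat.add_mul_mod_self_left, coloringArray_mod]
  rw [coloringArray, coloringArray, color_eq, add_assoc, ← mul_add] at h
  exact ⟨color_eq, Nat.eq_of_mul_eq_mul_left (κ p).pos (Nat.add_left_cancel h)⟩

theorem isArray_coloringArray (κ : (incGraph P).Coloring (Fin r)) :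
    IsArray r (coloringArray κ) := by
  refine ⟨fun p p' h => ?_, fun p p' h => ?_, fun p h => ?_⟩
  · obtain ⟨color_eq, rank_eq⟩ := chainRank_eq_of_coloringArray_eq κ (k := 0) h
    by_contra hne
    rcases le_or_ge_of_coloring_eq κ color_eq with hle | hle
    · exact (chainRank_lt_chainRank color_eq (hle.lt_of_ne hne)).ne rank_eq
    · exact (chainRank_lt_chainRank color_eq.symm (hle.lt_of_ne' hne)).ne' rank_eq
  · obtain ⟨color_eq, rank_eq⟩ := chainRank_eq_of_coloringArray_eq κ (k := 1) (by rwa [mul_one])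
    exact lt_of_chainRank_lt κ color_eq.symm (by omega)
  · have rank_pos : 0 < chainRank κ p := by
      refine Nat.pos_of_ne_zero fun rank_eq => h.not_gt ?_
      rw [coloringArray, rank_eq, mul_zero, add_zero]
      exact (κ p).isLt
    obtain ⟨p', color_eq, rank_eq⟩ := exists_chainRank_add_one κ rank_pos
    refine ⟨p', ?_⟩
    rw [coloringArray, coloringArray, color_eq, ← rank_eq]
    ring

theorem IsArray.exists_coloringArray_eq (hr : 0 < r) (hf : IsArray r f) :
    ∃ κ : (incGraph P).Coloring (Fin r), coloringArray κ = f := by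
  have valid {p p' : P} (incomp : (incGraph P).Adj p p') : f p % r ≠ f p' % r := by
    intro h
    rcases lt_trichotomy (f p) (f p') with hlt | heq | hlt
    · exact incomp.1 (hf.lt_of_mod_eq h hlt).le
    · exact incomp.1 (hf.injective heq).le
    · exact incomp.2 (hf.lt_of_mod_eq h.symm hlt).le
  let κ : (incGraph P).Coloring (Fin r) :=
    SimpleGraph.Coloring.mk (fun p => ⟨f p % r, Nat.mod_lt _ hr⟩)
      fun incomp h => valid incomp (congrArg Fin.val h)
  have color_eq_iff (p p' : P) : κ p' = κ p ↔ f p' % r = f p % r := Fin.ext_iff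
  refine ⟨κ, funext fun p => ?_⟩
  have rank_eq : chainRank κ p = f p / r := by
    rw [← hf.card_lt hr (hf.exists_add p), chainRank]
    congr 1
    ext p'
    simp only [mem_filter_univ, color_eq_iff]
    refine and_congr_right fun h => ⟨fun hlt => ?_, hf.lt_of_mod_eq h⟩
    by_contra! hle
    rcases hle.eq_or_lt with heq | hlt'
    · exact hlt.ne (hf.injective heq.symm)
    · exact hlt.asymm (hf.lt_of_mod_eq h.symm hlt')
  rw [coloringArray, rank_eq]
  exact Nat.mod_add_div _ _

theorem aeval_chromaticPoly_mul_vandermonde {R : Type*} [CommRing R] (hr : 0 < r) (y : Fin r → R) :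
    aeval (fun i => y i ^ r) (chromaticPoly (incGraph P) (Fin r)) * (Matrix.vandermonde y).det =
      ∑ f ∈ arrays P r, chainAlternant y f := by
  classical
  rw [← Matrix.det_transpose, aeval_chromaticPoly_mul_det]
  refine sum_bij (fun κ _ => coloringArray κ)
    (fun κ _ => (mem_arrays hr).2 (isArray_coloringArray κ))
    (fun κ _ κ' _ h => ?_) (fun f hf => ?_) fun κ _ => ?_
  · refine DFunLike.ext _ _ fun p => Fin.ext ?_
    rw [← coloringArray_mod, ← coloringArray_mod, h]
  · obtain ⟨κ, hκ⟩ := ((mem_arrays hr).1 hf).exists_coloringArray_eq hr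
    exact ⟨κ, mem_univ κ, hκ⟩
  · rw [chainAlternant]
    congr 2
    ext j i
    rw [Matrix.transpose_apply, Matrix.vandermonde_apply, ← pow_mul, ← pow_add, chainEnd]
    simp only [coloringArray_mod, Fin.val_inj]

end Arrays

/-! ### Cancellation of the arrays with flaws -/

section Cancellation

variable {P : Type*} [PartialOrder P] {r q : ℕ} {f : P → ℕ}

theorem hasFlaw_tailSwap_comp_iff (hr : 2 ≤ r) {x : ℕ} (h : tailSwap r q x = x)
    (h' : tailSwap r q (x + 1) = x + 1) : HasFlaw (tailSwap r q ∘ f) x ↔ HasFlaw f x := by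
  simp only [HasFlaw, Function.comp_apply, (tailSwap_involutive hr q).eq_iff, h, h']

theorem IsEarlyFlaw.tailSwap_comp (hr : 2 ≤ r) (hf : IsArray r f) (hq : IsEarlyFlaw f q) :
    IsEarlyFlaw (tailSwap r q ∘ f) q := by
  obtain ⟨c, hc, -⟩ := hq.hasFlaw
  refine ⟨⟨c, ?_, fun p hp => hf.lt_of_add c p ?_⟩, fun x hx => ?_⟩
  · rw [Function.comp_apply, hc, tailSwap_of_lt_of_lt (by omega) (by omega)]
  · rw [Function.comp_apply, (tailSwap_involutive hr q).eq_iff, tailSwap_self] at hp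
    rw [hp, hc]
  · rw [hasFlaw_tailSwap_comp_iff hr (tailSwap_of_lt (by omega)) (tailSwap_of_lt hx)]
    exact hq.not_hasFlaw x hx

/-- Going from `q + r` down to `q` along flaws, the entries would not increase, whereas those in
positions `q` and `q + r` belong to the same chain. -/
theorem IsArray.not_forall_hasFlaw (hr : 0 < r) (hf : IsArray r f) (q : ℕ) :
    ¬ ∀ i < r, HasFlaw f (q + i) := by
  intro flaw
  obtain ⟨last, hlast, -⟩ := flaw (r - 1) (by omega)
  obtain ⟨first, hfirst⟩ := hf.exists_add last (by omega)
  have le_first : ∀ i ≤ r, ∃ p, f p = q + i ∧ p ≤ first := by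
    intro i
    induction i with
    | zero => exact fun _ => ⟨first, by omega, le_rfl⟩
    | succ i ih =>
      intro hi
      obtain ⟨p, hp, hle⟩ := ih (by omega)
      obtain ⟨p', hp', hlt⟩ := flaw i (by omega)
      exact ⟨p', by omega, (hlt p hp).le.trans hle⟩
  obtain ⟨p, hp, hle⟩ := le_first r le_rfl
  exact (hf.lt_of_add first p (by omega)).not_ge hle

variable [Fintype P]

theorem lt_of_hasFlaw (hf : f ∈ arrays P r) (hq : HasFlaw f q) :
    q < r * (Fintype.card P + 1) := by
  classical
  obtain ⟨p, hp, -⟩ := hq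
  rw [arrays, mem_filter, Fintype.mem_piFinset] at hf
  have := mem_range.1 (hf.1 p)
  omega

variable {R : Type*} [CommRing R] [IsAddTorsionFree R] {y : Fin r → R}
  (hy : ∀ i, y i ^ (r + 1) = 1) (hP : IsThreePlusOneFree P) (hr : 0 < r)

include hy hP hr

open Classical in
theorem sum_chainAlternant_isEarlyFlaw {e : ℕ} (hqe : q < e) :
    ∑ f ∈ arrays P r with (∀ x, x + 1 < q → ¬ HasFlaw f x) ∧ ∀ x, q ≤ x → x < e → HasFlaw f x,
      chainAlternant y f = 0 := by
  by_cases her : q + r ≤ e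
  · refine sum_eq_zero fun f hf => ?_
    rw [mem_filter, mem_arrays hr] at hf
    exact absurd (fun i hi => hf.2.2 _ (by omega) (by omega)) (hf.1.not_forall_hasFlaw hr q)
  have hr' : 2 ≤ r := by omega
  have alternant_neg (f : P → ℕ) (hf : IsArray r f) (hq : IsEarlyFlaw f q) :=
    chainAlternant_tailSwap_comp hy hP hr' hf hq
  refine sum_involution (fun f _ => tailSwap r q ∘ f) (fun f hf => ?_) (fun f hf hne heq => ?_)
    (fun f hf => ?_) fun f _ => ?_
  all_goals try rw [mem_filter, mem_arrays hr] at hf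
  · rw [alternant_neg f hf.1 ⟨hf.2.2 q le_rfl hqe, hf.2.1⟩, add_neg_cancel]
  · have := alternant_neg f hf.1 ⟨hf.2.2 q le_rfl hqe, hf.2.1⟩
    rw [heq] at this
    exact hne (self_eq_neg.1 this)
  · obtain ⟨isArray, before, run⟩ := hf
    have early : IsEarlyFlaw f q := ⟨run q le_rfl hqe, before⟩
    have early' := early.tailSwap_comp hr' isArray
    rw [mem_filter, mem_arrays hr]
    refine ⟨isArray.tailSwap_comp hP hr' early, early'.not_hasFlaw, fun x hqx hxe => ?_⟩
    rcases hqx.eq_or_lt with rfl | hlt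
    · exact early'.hasFlaw
    · rw [hasFlaw_tailSwap_comp_iff hr' (tailSwap_of_lt_of_lt hlt (by omega))
        (tailSwap_of_lt_of_lt (by omega) (by omega))]
      exact run x hqx hxe
  · rw [← Function.comp_assoc, (tailSwap_involutive hr' q).comp_self, Function.id_comp]

open Classical in
/-- By induction on `q`: among the arrays with a run of flaws from `q + 1` on and no flaw before
`q`, those with a flaw at `q` have a longer run from `q` on. -/
theorem sum_chainAlternant_firstFlaw (q : ℕ) {e : ℕ} (hqe : q < e) :
    ∑ f ∈ arrays P r with (∀ x < q, ¬ HasFlaw f x) ∧ ∀ x, q ≤ x → x < e → HasFlaw f x,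
      chainAlternant y f = 0 := by
  induction q with
  | zero => simpa using sum_chainAlternant_isEarlyFlaw hy hP hr hqe
  | succ q ih =>
    have early := sum_chainAlternant_isEarlyFlaw hy hP hr hqe
    rw [← sum_filter_add_sum_filter_not _ (fun f => HasFlaw f q), filter_filter,
      filter_filter] at early
    have longer_run := ih (Nat.lt_of_succ_lt hqe)
    rw [← early, ← zero_add (∑ f ∈ _, _)]
    congr 1
    · rw [← longer_run]
      refine sum_congr (filter_congr fun f _ => ?_) fun _ _ => rfl
      constructor
      · exact fun ⟨before, run⟩ =>
          ⟨⟨fun x hx => before x (by omega), fun x hqx => run x (by omega)⟩,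
            run q le_rfl (by omega)⟩
      · rintro ⟨⟨before, run⟩, flaw⟩
        refine ⟨fun x hx => before x (by omega), fun x hqx hxe => ?_⟩
        rcases hqx.eq_or_lt with rfl | hlt
        exacts [flaw, run x hlt hxe]
    · refine sum_congr (filter_congr fun f _ => ?_) fun _ _ => rfl
      rw [Nat.forall_lt_succ_right]
      constructor
      · exact fun ⟨⟨before, no_flaw⟩, run⟩ =>
          ⟨⟨fun x hx => before x (by omega), run⟩, no_flaw⟩
      · exact fun ⟨⟨before, run⟩, no_flaw⟩ =>
          ⟨⟨fun x hx => before x (by omega), no_flaw⟩, run⟩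

open Classical in
theorem sum_chainAlternant_eq_sum_not_hasFlaw :
    ∑ f ∈ arrays P r, chainAlternant y f =
      ∑ f ∈ arrays P r with ∀ x, ¬ HasFlaw f x, chainAlternant y f := by
  have no_flaw_before (q : ℕ) : ∑ f ∈ arrays P r, chainAlternant y f =
      ∑ f ∈ arrays P r with ∀ x < q, ¬ HasFlaw f x, chainAlternant y f := by
    induction q with
    | zero => simp
    | succ q ih =>
      have first_flaw := sum_chainAlternant_firstFlaw hy hP hr q q.lt_succ_self
      have run_iff (f : P → ℕ) : (∀ x, q ≤ x → x < q + 1 → HasFlaw f x) ↔ HasFlaw f q :=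
        ⟨fun h => h q le_rfl q.lt_succ_self, fun h x hqx hx => by
          rwa [← Nat.le_antisymm hqx (Nat.lt_succ_iff.1 hx)]⟩
      simp only [run_iff] at first_flaw
      rw [ih, ← sum_filter_add_sum_filter_not _ (fun f => HasFlaw f q), filter_filter,
        filter_filter, first_flaw, zero_add]
      exact sum_congr (filter_congr fun f _ => Nat.forall_lt_succ_right.symm) fun _ _ => rfl
  rw [no_flaw_before (r * (Fintype.card P + 1))]
  refine sum_congr (filter_congr fun f hf => ?_) fun _ _ => rfl
  exact ⟨fun h x hx => h x (lt_of_hasFlaw hf hx) hx, fun h x _ => h x⟩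

end Cancellation

/-! ### Arrays without flaws -/

section NoFlaw

variable {P : Type*} [PartialOrder P] [Fintype P] {r : ℕ} {f : P → ℕ}

theorem exists_position_eq_iff_lt_card (hf : Function.Injective f) (h : ∀ x, ¬ HasFlaw f x)
    (x : ℕ) : (∃ p, f p = x) ↔ x < Fintype.card P := by
  classical
  have exists_of_le (p : P) : ∀ y ≤ f p, ∃ p', f p' = y := by
    intro y hy
    induction hy using Nat.decreasingInduction with
    | self => exact ⟨p, rfl⟩
    | of_succ k _ ih =>
      obtain ⟨p', hp'⟩ := ih
      by_contra! hne
      exact h k ⟨p', hp', fun p hp => absurd hp (hne p)⟩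
  have card_image : #(univ.image f) = Fintype.card P := card_image_of_injective _ hf
  have image_subset : univ.image f ⊆ range (Fintype.card P) := by
    intro y hy
    obtain ⟨p, -, rfl⟩ := mem_image.1 hy
    have range_subset : range (f p + 1) ⊆ univ.image f := fun y hy => by
      simpa using exists_of_le p y (Nat.lt_succ_iff.1 (mem_range.1 hy))
    simpa [card_image] using card_le_card range_subset
  have image_eq := eq_of_subset_of_card_le image_subset (by rw [card_image, card_range])
  rw [← mem_range, ← image_eq]
  simp

theorem val_finRotate_pow {r : ℕ} (n : ℕ) (t : Fin r) :
    ((finRotate r ^ n) t : ℕ) = (n + t) % r := by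
  have := t.neZero
  induction n with
  | zero => simp [Nat.mod_eq_of_lt t.isLt]
  | succ n ih =>
    rw [pow_succ', Equiv.Perm.mul_apply, finRotate_apply, Fin.val_add, ih, Fin.val_one',
      ← Nat.add_mod, add_right_comm]

theorem IsArray.chainEnd_finRotate_pow (hf : IsArray r f) (h : ∀ x, ¬ HasFlaw f x) (t : Fin r) :
    chainEnd r f ((finRotate r ^ Fintype.card P) t) = Fintype.card P + t := by
  have filled_iff := exists_position_eq_iff_lt_card hf.injective h
  rw [val_finRotate_pow]
  refine IsChainEnd.chainEnd_eq t.pos hf ⟨fun p hp => ?_, fun hle => ?_⟩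
  · have := (filled_iff _).1 ⟨p, hp⟩
    omega
  · obtain ⟨p, hp⟩ := (filled_iff (Fintype.card P + t - r)).2 (by omega)
    exact ⟨p, by omega⟩

theorem IsArray.chainAlternant_of_not_hasFlaw {R : Type*} [CommRing R] (hf : IsArray r f)
    (h : ∀ x, ¬ HasFlaw f x) (y : Fin r → R) :
    chainAlternant y f =
      ((-1) ^ (r - 1) * ∏ i, y i) ^ Fintype.card P * (Matrix.vandermonde y).det := by
  have det_rotate := Matrix.det_permute (finRotate r ^ Fintype.card P)
    (Matrix.of fun j i : Fin r => y i ^ chainEnd r f j)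
  have det_shift := Matrix.det_mul_row (fun i => y i ^ Fintype.card P)
    (Matrix.vandermonde y).transpose
  simp only [Matrix.transpose_apply, Matrix.vandermonde_apply, ← pow_add, Matrix.det_transpose,
    prod_pow] at det_shift
  simp only [Matrix.submatrix, Matrix.of_apply, hf.chainEnd_finRotate_pow h, id, map_pow,
    sign_finRotate, det_shift] at det_rotate
  have sign_mul_self : (((-1) ^ (r - 1)) ^ Fintype.card P : R) * ((-1) ^ (r - 1)) ^ Fintype.card P
      = 1 := by
    rw [← mul_pow, ← mul_pow]
    simp
  rw [chainAlternant, mul_pow, mul_assoc, det_rotate]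
  push_cast
  rw [← mul_assoc, sign_mul_self, one_mul]

end NoFlaw

/-! ### The sum of the coefficients -/

section SumCoeff

variable {P : Type*} [PartialOrder P] [Fintype P] {r : ℕ} (hP : IsThreePlusOneFree P) (hr : 0 < r)

include hP hr

open Classical in
theorem aeval_nontrivialRoot_chromaticPoly_incGraph {R : Type*} [CommRing R] [IsDomain R]
    [CharZero R] {ζ : R} (hζ : IsPrimitiveRoot ζ (r + 1)) :
    aeval (nontrivialRoot r ζ) (chromaticPoly (incGraph P) (Fin r)) =
      (-1) ^ Fintype.card P * #{f ∈ arrays P r | ∀ x, ¬ HasFlaw f x} := by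
  have hζr : IsPrimitiveRoot (ζ ^ r) (r + 1) :=
    hζ.pow_of_coprime r (Nat.coprime_self_add_right.2 (Nat.coprime_one_right r))
  set y := nontrivialRoot r (ζ ^ r)
  have root_eq : nontrivialRoot r ζ = fun i => y i ^ r := by
    have pow_mul_self : (ζ ^ r) ^ r = ζ := by
      obtain ⟨m, rfl⟩ := Nat.exists_eq_add_of_le' hr
      rw [← pow_mul, show (m + 1) * (m + 1) = (m + 1 + 1) * m + 1 by ring, pow_succ, pow_mul,
        hζ.pow_eq_one, one_pow, one_mul]
    funext i
    rw [← nontrivialRoot_pow, pow_mul_self]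
  have vandermonde_ne_zero : (Matrix.vandermonde y).det ≠ 0 :=
    Matrix.det_vandermonde_ne_zero_iff.2 (nontrivialRoot_injective hζr)
  have sign_eq : (-1) ^ (r - 1) * ∏ i, y i = -1 := by
    rw [prod_nontrivialRoot hζr, ← pow_add, show r - 1 + r = 2 * (r - 1) + 1 by omega, pow_succ,
      pow_mul, neg_one_sq, one_pow, one_mul]
  have alternant_eq (f) (hf : f ∈ ({f ∈ arrays P r | ∀ x, ¬ HasFlaw f x} : Finset (P → ℕ))) :
      chainAlternant y f = (-1) ^ Fintype.card P * (Matrix.vandermonde y).det := by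
    rw [mem_filter, mem_arrays hr] at hf
    rw [hf.1.chainAlternant_of_not_hasFlaw hf.2, sign_eq]
  apply mul_right_cancel₀ vandermonde_ne_zero
  rw [root_eq, aeval_chromaticPoly_mul_vandermonde hr,
    sum_chainAlternant_eq_sum_not_hasFlaw (nontrivialRoot_pow_succ hζr) hP hr,
    sum_congr rfl alternant_eq, sum_const, nsmul_eq_mul]
  ring

theorem sum_coeff_eq_ncard {c : Nat.Partition (Fintype.card P) → ℤ}
    (hc : IsElemExpansion (incGraph P) c) :
    ∑ ν with ∀ k ∈ ν.parts, k ≤ r, c ν =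
      ({f : P → ℕ | IsArray r f ∧ ∀ x, ¬ HasFlaw f x}.ncard : ℤ) := by
  classical
  have hζ := Complex.isPrimitiveRoot_exp (r + 1) r.succ_ne_zero
  have eval_eq := (aeval_nontrivialRoot_chromaticPoly hζ hc).symm.trans
    (aeval_nontrivialRoot_chromaticPoly_incGraph hP hr hζ)
  have set_eq : {f : P → ℕ | IsArray r f ∧ ∀ x, ¬ HasFlaw f x} =
      ({f ∈ arrays P r | ∀ x, ¬ HasFlaw f x} : Finset (P → ℕ)) := by
    ext f
    simp [mem_arrays hr]
  rw [set_eq, Set.ncard_coe_finset]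
  exact_mod_cast mul_left_cancel₀ (pow_ne_zero _ (neg_ne_zero.2 one_ne_zero)) eval_eq

end SumCoeff

/-! ### Row reading of standard cylindric tableaux -/

section RowReading

variable {n r : ℕ}

theorem mem_rowsDiagram (hr : 0 < r) {i j : ℕ} :
    (i, j) ∈ rowsDiagram n r ↔ j < r ∧ i * r + j < n := by
  have hdiv : r * (n / r) + n % r = n := Nat.div_add_mod n r
  have hmod : n % r < r := Nat.mod_lt n hr
  simp only [rowsDiagram, YoungDiagram.mem_ofRowLens, List.length_append, List.length_replicate,
    List.length_singleton, List.getElem_append, List.getElem_replicate, List.getElem_singleton]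
  rcases lt_trichotomy i (n / r) with hi | rfl | hi
  · have hrow : i * r + r ≤ r * (n / r) := by
      rw [← Nat.succ_mul, mul_comm]
      exact Nat.mul_le_mul_left r hi
    simp only [dif_pos hi, exists_prop]
    omega
  · simp only [lt_irrefl, dite_false, exists_prop, mul_comm (n / r)]
    omega
  · have hrow : r * (n / r) + r ≤ i * r := by
      rw [← Nat.mul_succ, mul_comm i]
      exact Nat.mul_le_mul_left r hi
    simp only [dif_neg hi.not_gt, exists_prop]
    omega

theorem mem_skewCells_rowsDiagram (hr : 0 < r) {b : ℕ × ℕ} :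
    b ∈ skewCells (rowsDiagram n r) ⊥ ↔ b.2 < r ∧ b.1 * r + b.2 < n := by
  rw [skewCells, YoungDiagram.cells_bot, sdiff_empty, YoungDiagram.mem_cells]
  exact mem_rowsDiagram hr

theorem lt_rowLen_rowsDiagram (hr : 0 < r) {j : ℕ} :
    j < (rowsDiagram n r).rowLen 0 ↔ j < r ∧ j < n := by
  rw [← YoungDiagram.mem_iff_lt_rowLen, mem_rowsDiagram hr, zero_mul, zero_add]

/-- The boxes of `(r^c t)` numbered row by row. -/
@[simps]
def cellEquiv (n : ℕ) (hr : 0 < r) : skewCells (rowsDiagram n r) ⊥ ≃ Fin n where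
  toFun b := ⟨b.1.1 * r + b.1.2, ((mem_skewCells_rowsDiagram hr).1 b.2).2⟩
  invFun x := ⟨(x / r, x % r), (mem_skewCells_rowsDiagram hr).2
    ⟨Nat.mod_lt _ hr, by rw [Nat.div_add_mod']; exact x.2⟩⟩
  left_inv b := by
    have hcol : b.1.2 < r := ((mem_skewCells_rowsDiagram hr).1 b.2).1
    ext
    · simp [mul_comm, Nat.mul_add_div hr, Nat.div_eq_of_lt hcol]
    · simp [Nat.mod_eq_of_lt hcol]
  right_inv x := Fin.ext (Nat.div_add_mod' _ _)

variable {P : Type*}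

/-- The filling of `(r^c t)` whose rows, read one after the other, list the elements of `P` in the
order given by `e`. -/
def rowFilling (hr : 0 < r) (e : P ≃ Fin n) : skewCells (rowsDiagram n r) ⊥ → P :=
  e.symm ∘ cellEquiv n hr

theorem toFilling_rowFilling_eq_some_iff (hr : 0 < r) (e : P ≃ Fin n) (i j : ℕ) (a : P) :
    toFilling (rowFilling hr e) (i, j) = some a ↔ j < r ∧ (e a : ℕ) = i * r + j := by
  simp only [toFilling, Option.dite_none_right_eq_some, mem_skewCells_rowsDiagram hr,
    Option.some_inj, rowFilling, Function.comp_apply, Equiv.symm_apply_eq, Fin.ext_iff,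
    cellEquiv_apply_val]
  have := (e a).2
  constructor
  · rintro ⟨hb, h⟩
    exact ⟨hb.1, h.symm⟩
  · rintro ⟨hj, h⟩
    exact ⟨⟨hj, h ▸ this⟩, h.symm⟩

theorem glue_rowFilling_eq_some_iff (hr : 0 < r) (e : P ≃ Fin n) (i j : ℕ) (a : P) :
    glue (toFilling (rowFilling hr e)) ((rowsDiagram n r).rowLen 0) 1 (i, j) = some a ↔
      (j < (rowsDiagram n r).rowLen 0 ∧ (e a : ℕ) + r = i * r + j) ∨
      (j = (rowsDiagram n r).rowLen 0 ∧ (e a : ℕ) = i * r) := by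
  have hcol := lt_rowLen_rowsDiagram (n := n) hr (j := j)
  rw [glue]
  dsimp only
  split_ifs with hj hi hj'
  · obtain ⟨i, rfl⟩ := Nat.exists_eq_add_of_le' hi
    rw [Nat.add_sub_cancel, toFilling_rowFilling_eq_some_iff, add_mul]
    omega
  · obtain rfl : i = 0 := by omega
    simp only [false_iff]
    omega
  · rw [toFilling_rowFilling_eq_some_iff]
    omega
  · simp only [false_iff]
    omega

variable [PartialOrder P]

theorem glue_rowFilling_columns_iff (hr : 0 < r) (e : P ≃ Fin n) :
    (∀ i j a b,
      glue (toFilling (rowFilling hr e)) ((rowsDiagram n r).rowLen 0) 1 (i, j) = some a →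
      glue (toFilling (rowFilling hr e)) ((rowsDiagram n r).rowLen 0) 1 (i + 1, j) = some b →
      a < b) ↔ ∀ a b, (e b : ℕ) = e a + r → a < b := by
  simp only [glue_rowFilling_eq_some_iff, add_mul, one_mul]
  constructor
  · intro hcol a b hab
    have hdiv := Nat.div_add_mod' (e a : ℕ) r
    have hmod := Nat.mod_lt (e a : ℕ) hr
    have hrow := (lt_rowLen_rowsDiagram (n := n) hr (j := e a % r)).2 (by omega)
    refine hcol (e a / r + 1) (e a % r) a b (Or.inl ⟨hrow, ?_⟩) (Or.inl ⟨hrow, ?_⟩) <;>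
    · rw [add_mul]
      omega
  · intro h i j a b ha hb
    exact h a b (by omega)

theorem glue_rowFilling_rows_iff (hr : 0 < r) (e : P ≃ Fin n) :
    (∀ i j a b,
      glue (toFilling (rowFilling hr e)) ((rowsDiagram n r).rowLen 0) 1 (i, j) = some a →
      glue (toFilling (rowFilling hr e)) ((rowsDiagram n r).rowLen 0) 1 (i, j + 1) = some b →
      ¬ b < a) ↔ ∀ a b, (e b : ℕ) = e a + 1 → ¬ b < a := by
  have hlen := fun j => lt_rowLen_rowsDiagram (n := n) hr (j := j)
  simp only [glue_rowFilling_eq_some_iff]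
  generalize (rowsDiagram n r).rowLen 0 = l at hlen
  constructor
  · intro hrow a b hab
    have hdiv := Nat.div_add_mod' (e a : ℕ) r
    have hmod := Nat.mod_lt (e a : ℕ) hr
    have ha := (hlen (e a % r)).2 (by omega)
    have hnext := hlen (e a % r + 1)
    refine hrow (e a / r + 1) (e a % r) a b (Or.inl ⟨ha, ?_⟩) ?_ <;> rw [add_mul] <;> omega
  · intro h i j a b ha hb
    refine h a b ?_
    have hj := hlen j
    have hl := hlen l
    rcases hb with ⟨_, hb⟩ | ⟨hjl, hb⟩
    · omega
    · -- A one-row shape with `n < r`: the glued column stands in row `0`, the tableau in row `1`.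
      rcases i with _ | i
      · omega
      · rw [add_mul] at ha hb
        omega

/-- The listing `e` of `P` satisfies the `P`-tableau conditions when it is written down in rows of
length `r`, the beginning of each row being regarded as adjacent to the end of the previous one. -/
structure IsRowListing (r : ℕ) (e : P ≃ Fin n) : Prop where
  lt_of_eq_add : ∀ a b, (e b : ℕ) = e a + r → a < b
  not_lt_of_eq_add_one : ∀ a b, (e b : ℕ) = e a + 1 → ¬ b < a

theorem isCylindricPTableau_rowFilling_iff (hr : 0 < r) (e : P ≃ Fin n) :
    IsCylindricPTableau (rowsDiagram n r) ⊥ 1 (rowFilling hr e) ↔ IsRowListing r e := by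
  rw [IsCylindricPTableau, IsPTableau, glue_rowFilling_columns_iff, glue_rowFilling_rows_iff]
  exact ⟨fun h => ⟨h.1, h.2⟩, fun h => ⟨h.1, h.2⟩⟩

theorem standardCylindric_eq_image (hr : 0 < r) :
    standardCylindric P (rowsDiagram n r) ⊥ 1 =
      rowFilling hr '' {e : P ≃ Fin n | IsRowListing r e} := by
  ext T
  constructor
  · rintro ⟨hT, hstd⟩
    let listing : P ≃ Fin n :=
      (Equiv.ofBijective T (Function.bijective_iff_existsUnique T |>.2 hstd)).symm.trans
        (cellEquiv n hr)
    have heq : rowFilling hr listing = T := by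
      ext b
      simp [rowFilling, listing]
    exact ⟨listing, (isCylindricPTableau_rowFilling_iff hr listing).1 (heq.symm ▸ hT), heq⟩
  · rintro ⟨e, he, rfl⟩
    exact ⟨(isCylindricPTableau_rowFilling_iff hr e).2 he,
      Function.bijective_iff_existsUnique _ |>.1 (e.symm.bijective.comp (cellEquiv n hr).bijective)⟩

theorem isArray_and_not_hasFlaw_iff (e : P ≃ Fin n) :
    (IsArray r (fun p => (e p : ℕ)) ∧ ∀ x, ¬ HasFlaw (fun p => (e p : ℕ)) x) ↔
      IsRowListing r e := by
  have exists_eq (x : ℕ) (hx : x < n) : ∃ p, (e p : ℕ) = x := ⟨e.symm ⟨x, hx⟩, by simp⟩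
  constructor
  · rintro ⟨harr, hflaw⟩
    refine ⟨harr.lt_of_add, fun a b hab hlt => hflaw (e a) ⟨b, hab, fun p hp => ?_⟩⟩
    rwa [harr.injective hp]
  · intro he
    refine ⟨⟨Fin.val_injective.comp e.injective, he.lt_of_eq_add, fun p hp => ?_⟩, ?_⟩
    · obtain ⟨p', hp'⟩ := exists_eq (e p - r) (by omega)
      exact ⟨p', by omega⟩
    · rintro x ⟨b, hb, hlt⟩
      obtain ⟨a, rfl⟩ := exists_eq x (Nat.lt_of_succ_lt (hb.symm.trans_lt (e b).2))
      exact he.not_lt_of_eq_add_one a b hb (hlt a rfl)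

theorem setOf_isArray_not_hasFlaw_eq_image [Fintype P] :
    {f : P → ℕ | IsArray r f ∧ ∀ x, ¬ HasFlaw f x} =
      (fun e p => (e p : ℕ)) '' {e : P ≃ Fin (Fintype.card P) | IsRowListing r e} := by
  ext f
  constructor
  · rintro ⟨harr, hflaw⟩
    have hpos := exists_position_eq_iff_lt_card harr.injective hflaw
    let listing : P ≃ Fin (Fintype.card P) :=
      Equiv.ofBijective (fun p => ⟨f p, (hpos _).1 ⟨p, rfl⟩⟩)
        ⟨fun p p' h => harr.injective (Fin.ext_iff.1 h),
          fun x => ((hpos x).2 x.2).imp fun p hp => Fin.ext hp⟩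
    exact ⟨listing, (isArray_and_not_hasFlaw_iff listing).1 ⟨harr, hflaw⟩, rfl⟩
  · rintro ⟨e, he, rfl⟩
    exact (isArray_and_not_hasFlaw_iff e).2 he

theorem ncard_standardCylindric [Fintype P] (hr : 0 < r) :
    (standardCylindric P (rowsDiagram (Fintype.card P) r) ⊥ 1).ncard =
      {f : P → ℕ | IsArray r f ∧ ∀ x, ¬ HasFlaw f x}.ncard := by
  have rowFilling_injective : Function.Injective (rowFilling (P := P) (n := Fintype.card P) hr) :=
    fun e e' h => Equiv.symm_bijective.injective <| DFunLike.coe_injective <|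
      (cellEquiv _ hr).surjective.injective_comp_right h
  have positions_injective :
      Function.Injective fun (e : P ≃ Fin (Fintype.card P)) p => (e p : ℕ) :=
    fun e e' h => Equiv.ext fun p => Fin.ext (congrFun h p)
  rw [standardCylindric_eq_image hr, setOf_isArray_not_hasFlaw_eq_image,
    Set.ncard_image_of_injective _ rowFilling_injective,
    Set.ncard_image_of_injective _ positions_injective]

end RowReading

end CylindricTableaux

theorem mainTheorem4 (P : Type*) [Fintype P] [PartialOrder P]
    (hP : CylindricTableaux.IsThreePlusOneFree P) (r : ℕ) (hr : 0 < r) :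
    (∃! c : Nat.Partition (Fintype.card P) → ℤ,
      CylindricTableaux.IsElemExpansion (CylindricTableaux.incGraph P) c) ∧
    ∀ c : Nat.Partition (Fintype.card P) → ℤ,
      CylindricTableaux.IsElemExpansion (CylindricTableaux.incGraph P) c →
      ∑ ν : Nat.Partition (Fintype.card P) with (∀ p ∈ ν.parts, p ≤ r), c ν =
        ((CylindricTableaux.standardCylindric P
          (CylindricTableaux.rowsDiagram (Fintype.card P) r) ⊥ 1).ncard : ℤ) := by
  refine ⟨CylindricTableaux.existsUnique_isElemExpansion _, fun c hc => ?_⟩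
  rw [CylindricTableaux.ncard_standardCylindric hr]
  exact CylindricTableaux.sum_coeff_eq_ncard hP hr hc
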